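/- Let $a\colon(0,\infty)\to(0,\infty)$ be continuous with $a(\tau)=\tau+o(\tau^{1+\varepsilon})$ as $\tau\searrow 0$ for some $\varepsilon>0$, and consider the Milne-like spacetime $(0,\infty)\times\mathbb R^3$ with metric $-d\tau^2+a(\tau)^2h$, where $h=dR^2+\sinh^2\!R\,(d\theta^2+\sin^2\theta\,d\phi^2)$ is the complete hyperbolic metric of curvature $-1$ and $\partial_\tau$ is future-pointing. Fix $\tau_0>0$ and put $b(\tau)=\exp\big(\int_{\tau_0}^{\tau}ds/a(s)\big)$, $t=b(\tau)\cosh R$, $r=b(\tau)\sinh R$; let $(x,y,z)$ be the Cartesian coordinates with spherical coordinates $(r,\theta,\phi)$. Let $(M,g)$ be a PT extension of this spacetime: $M\subset\mathbb R^4$ is open, with coordinates $(t,x,y,z)$, and contains the light cone $\{t^2=x^2+y^2+z^2\}$ of the origin $\mathscr O=0$; $g$ is a time-oriented $C^2$ Lorentzian metric on $M$; the coordinates above embed the Milne-like spacetime into $(M,g)$ isometrically, preserving the time orientation; and $(t,x,y,z)\mapsto(-t,-x,-y,-z)$ maps $M$ to $M$ and is an isometry of $g$. Let $J=J^+(\mathscr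 O)\cup J^-(\mathscr O)$ be the union of the causal future and the causal past of $\mathscr O$ in $(M,g)$ (both contain $\mathscr O$). Let $1\le k\le\infty$. An $\mathscr O$-fixing causal isometry is a bijection $f\colon J\to J$ such that (1) $f(\mathscr O)=\mathscr O$; (2) $f$ is a $C^k$ diffeomorphism of $J\setminus\{\mathscr O\}$ onto itself; (3) $f$ has a differential (as a map on $J$) at $\mathscr O$, and $g_q(X,Y)=g_{f(q)}(df_qX,df_qY)$ for all $q\in J$, including $q=\mathscr O$, and all $X,Y\in T_qM$. **Theorem.** The set $J\setminus\{\mathscr O\}$ is a smooth manifold with boundary (embedded in $M$, of dimension four). The $\mathscr O$-fixing causal isometries form a group under composition, and this group is isomorphic to the Lorentz group $\mathrm O(1,3)=\{\Lambda\in \mathrm{GL}(4,\mathbb R):\Lambda^{T}\eta\Lambda=\eta\}$, $\eta=\mathrm{diag}(-1,1,1,1)$. An isomorphism sends $\Lambda\in\mathrm O(1,3)$ to the map $x\mapsto\Lambda x$ on $J$ in the coordinates $(t,x,y,z)$, whose differential at $\mathscr O$ is $\Lambda$; thus every $\mathscr O$-fixing causal isometry is the restriction to $J$ of exactly one Lorentz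 transformation, namely its differential at $\mathscr O$. -/

import Mathlib

open Set Filter Topology Matrix
open scoped ContDiff

noncomputable section

namespace Milne

/-! ## The Lorentz group -/

/-- The coordinate space with coordinates `(t, x, y, z)`. -/
abbrev R4 : Type := Fin 4 → ℝ

/-- The coordinate space underlying hyperbolic space. -/
abbrev R3 : Type := Fin 3 → ℝ

/-- The Minkowski matrix `diag(-1, 1, 1, 1)`. -/
def eta : Matrix (Fin 4) (Fin 4) ℝ := Matrix.diagonal ![-1, 1, 1, 1]

/-- The Lorentz group `O(1,3)`: invertible matrices `Λ` with `Λᵀ η Λ = η`. -/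
def lorentzGroup : Subgroup (GL (Fin 4) ℝ) where
  carrier := {A | (A : Matrix (Fin 4) (Fin 4) ℝ)ᵀ * eta * A = eta}
  one_mem' := by simp
  mul_mem' := by
    intro A B hA hB
    simp only [mem_ofPred_eq] at hA hB ⊢
    calc ((A * B : GL (Fin 4) ℝ) : Matrix (Fin 4) (Fin 4) ℝ)ᵀ * eta
          * ((A * B : GL (Fin 4) ℝ) : Matrix (Fin 4) (Fin 4) ℝ)
        = (B : Matrix (Fin 4) (Fin 4) ℝ)ᵀ
            * ((A : Matrix (Fin 4) (Fin 4) ℝ)ᵀ * eta * A) * B := by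
          simp only [Units.val_mul, Matrix.transpose_mul, Matrix.mul_assoc]
      _ = eta := by rw [hA, hB]
  inv_mem' := by
    intro A hA
    simp only [mem_ofPred_eq] at hA ⊢
    have h1 : (A : Matrix (Fin 4) (Fin 4) ℝ) * ((A⁻¹ : GL (Fin 4) ℝ) : Matrix _ _ ℝ) = 1 := by
      rw [← Units.val_mul, mul_inv_cancel, Units.val_one]
    have h2 : (((A⁻¹ : GL (Fin 4) ℝ) : Matrix (Fin 4) (Fin 4) ℝ))ᵀ
        * (A : Matrix (Fin 4) (Fin 4) ℝ)ᵀ = 1 := by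
      rw [← Matrix.transpose_mul, h1, Matrix.transpose_one]
    calc (((A⁻¹ : GL (Fin 4) ℝ) : Matrix (Fin 4) (Fin 4) ℝ))ᵀ * eta
          * ((A⁻¹ : GL (Fin 4) ℝ) : Matrix (Fin 4) (Fin 4) ℝ)
        = ((((A⁻¹ : GL (Fin 4) ℝ) : Matrix (Fin 4) (Fin 4) ℝ))ᵀ
            * (A : Matrix (Fin 4) (Fin 4) ℝ)ᵀ) * eta
          * ((A : Matrix (Fin 4) (Fin 4) ℝ)
            * ((A⁻¹ : GL (Fin 4) ℝ) : Matrix (Fin 4) (Fin 4) ℝ)) := by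
          rw [← congrArg (fun N => (((A⁻¹ : GL (Fin 4) ℝ) : Matrix (Fin 4) (Fin 4) ℝ))ᵀ * N
            * ((A⁻¹ : GL (Fin 4) ℝ) : Matrix (Fin 4) (Fin 4) ℝ)) hA]
          simp only [Matrix.mul_assoc]
      _ = eta := by rw [h1, h2, Matrix.one_mul, Matrix.mul_one]

/-! ## Milne-like spacetimes -/

/-- Scale factors of Milne-like spacetimes with cosmic time `τ ∈ (0, ∞)`:
`a` is positive and continuous, and `a(τ) = τ + o(τ^(1+ε))` as `τ ↘ 0`, for some `ε > 0`. -/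
structure IsScaleFactor (a : ℝ → ℝ) : Prop where
  pos : ∀ τ, 0 < τ → 0 < a τ
  continuousOn : ContinuousOn a (Ioi 0)
  asymp : ∃ ε : ℝ, 0 < ε ∧
    (fun τ => a τ - τ) =o[𝓝[>] (0 : ℝ)] (fun τ => τ ^ (1 + ε))

/-- The complete hyperbolic metric of curvature `-1` on `ℝ³`, in the coordinates in which the
hyperboloid `{t = √(1 + |w|²)}` of Minkowski space is the graph over `w ∈ ℝ³`. With
`w = sinh R • ω`, where `ω` is a unit vector, it is `dR² + sinh² R (dθ² + sin² θ dφ²)`. -/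
def hyperbolicMetric (w u v : R3) : ℝ :=
  u ⬝ᵥ v - (w ⬝ᵥ u) * (w ⬝ᵥ v) / (1 + w ⬝ᵥ w)

/-- The Milne-like metric `-dτ² + a(τ)² h` at the point `p = (τ, w)` of `(0, ∞) × ℝ³`. -/
def milneMetric (a : ℝ → ℝ) (p u v : ℝ × R3) : ℝ :=
  -(u.1 * v.1) + a p.1 ^ 2 * hyperbolicMetric p.2 u.2 v.2

/-- `b(τ) = exp (∫_{τ₀}^τ ds / a(s))`. -/
def radius (a : ℝ → ℝ) (τ₀ τ : ℝ) : ℝ := Real.exp (∫ s in τ₀..τ, 1 / a s)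

/-- The coordinates `(t, x, y, z)` of the point `(τ, w)` of the Milne-like spacetime:
`t = b(τ) cosh R` and `(x, y, z) = b(τ) sinh R • ω`, where `w = sinh R • ω`. -/
def coords (a : ℝ → ℝ) (τ₀ : ℝ) (p : ℝ × R3) : R4 :=
  radius a τ₀ p.1 • (Fin.cons (Real.sqrt (1 + p.2 ⬝ᵥ p.2)) p.2 : R4)

/-! ## Spacetimes and causality -/

/-- A spacetime with global coordinates: an open subset of `ℝ⁴` with a `C²` Lorentzian metric
and a time orientation, given by a continuous timelike vector field. -/
structure CoordSpacetime where
  carrier : Set R4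
  isOpen_carrier : IsOpen carrier
  metric : R4 → R4 →L[ℝ] R4 →L[ℝ] ℝ
  contDiffOn_metric : ContDiffOn ℝ 2 metric carrier
  metric_symm : ∀ p ∈ carrier, ∀ u v, metric p u v = metric p v u
  /-- Every tangent space has an orthonormal basis of signature `(-, +, +, +)`. -/
  lorentzian : ∀ p ∈ carrier, ∃ e : Module.Basis (Fin 4) ℝ R4,
    ∀ i j, metric p (e i) (e j) = eta i j
  timeField : R4 → R4
  continuousOn_timeField : ContinuousOn timeField carrier
  timeField_timelike : ∀ p ∈ carrier, metric p (timeField p) (timeField p) < 0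

namespace CoordSpacetime

variable (S : CoordSpacetime)

/-- `v` is a future directed causal (timelike or null, nonzero) tangent vector at `p`. -/
def IsFutureCausal (p v : R4) : Prop :=
  v ≠ 0 ∧ S.metric p v v ≤ 0 ∧ S.metric p (S.timeField p) v < 0

/-- There is a future directed causal curve of class `C¹` in the spacetime from `p` to `q`. -/
def CausalStep (p q : R4) : Prop :=
  ∃ γ : ℝ → R4, ContDiffOn ℝ 1 γ (Icc 0 1) ∧ γ 0 = p ∧ γ 1 = q ∧
    ∀ s ∈ Icc (0 : ℝ) 1, γ s ∈ S.carrier ∧ S.IsFutureCausal (γ s) (derivWithin γ (Icc 0 1) s)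

/-- The causal future `J⁺(p)`: the point `p` and all the points that are reached from `p` along
future directed causal curves which are piecewise of class `C¹`. -/
def causalFuture (p : R4) : Set R4 := {q | Relation.ReflTransGen S.CausalStep p q}

/-- The causal past `J⁻(p)`. -/
def causalPast (p : R4) : Set R4 := {q | Relation.ReflTransGen S.CausalStep q p}

/-- `J⁺(p) ∪ J⁻(p)`. -/
def causalSet (p : R4) : Set R4 := S.causalFuture p ∪ S.causalPast p

end CoordSpacetime

/-- A subset of `ℝ⁴` is a (smooth, embedded) manifold with boundary of dimension four: each of
its points is interior, or the set is given near the point by an inequality `0 ≤ u` where `u` is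
smooth with nonzero differential. -/
def IsManifoldWithBoundary (A : Set R4) : Prop :=
  ∀ p ∈ A, A ∈ 𝓝 p ∨ ∃ U : Set R4, IsOpen U ∧ p ∈ U ∧ ∃ u : R4 → ℝ,
    ContDiffOn ℝ ∞ u U ∧ u p = 0 ∧ fderiv ℝ u p ≠ 0 ∧ A ∩ U = {x ∈ U | 0 ≤ u x}

/-- The extension of a self-map of a subset of `ℝ⁴` to all of `ℝ⁴`, by the identity. Only its
values and its derivatives within the subset are ever used. -/
def extendMap {A : Set R4} (f : A → A) : R4 → R4 :=
  Function.extend Subtype.val (fun x => (f x : R4)) id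

/-- A bijection `f` of `J⁺(p) ∪ J⁻(p)` is a `p`-fixing causal isometry: it fixes `p`, it is a
diffeomorphism (of class `C^k`) on `[J⁺(p) ∪ J⁻(p)] \ {p}`, it has a differential at `p`, and its
differentials at all the points of `J⁺(p) ∪ J⁻(p)`, including `p`, preserve the metric. -/
structure IsFixingCausalIsometry (S : CoordSpacetime) (k : ℕ∞) (p : R4)
    (f : Equiv.Perm (S.causalSet p)) : Prop where
  fixes : ∀ x : S.causalSet p, (x : R4) = p → (f x : R4) = p
  contDiffOn : ContDiffOn ℝ k (extendMap f) (S.causalSet p \ {p})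
  contDiffOn_symm : ContDiffOn ℝ k (extendMap f.symm) (S.causalSet p \ {p})
  differentiableWithinAt : DifferentiableWithinAt ℝ (extendMap f) (S.causalSet p) p
  isometry : ∀ (q : S.causalSet p) (X Y : R4),
    S.metric q X Y = S.metric (f q)
      (fderivWithin ℝ (extendMap f) (S.causalSet p) q X)
      (fderivWithin ℝ (extendMap f) (S.causalSet p) q Y)

/-! ## PT extensions -/

/-- `S` is a PT extension, in the coordinates `(t, x, y, z)` given by `coords a τ₀`, of the
Milne-like spacetime with scale factor `a`. The origin `𝒪` is `0 : R4`. -/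
structure IsPTExtension (a : ℝ → ℝ) (τ₀ : ℝ) (S : CoordSpacetime) : Prop where
  /-- The Milne-like spacetime lies in `S`. -/
  coords_mem : ∀ (τ : ℝ) (w : R3), 0 < τ → coords a τ₀ (τ, w) ∈ S.carrier
  /-- The inclusion of the Milne-like spacetime is isometric. -/
  isometric : ∀ (τ : ℝ) (w : R3), 0 < τ → ∀ u v : ℝ × R3,
    S.metric (coords a τ₀ (τ, w)) (fderiv ℝ (coords a τ₀) (τ, w) u)
      (fderiv ℝ (coords a τ₀) (τ, w) v) = milneMetric a (τ, w) u v
  /-- On the Milne-like spacetime, `∂/∂τ` is future directed. -/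
  future : ∀ (τ : ℝ) (w : R3), 0 < τ →
    S.metric (coords a τ₀ (τ, w)) (S.timeField (coords a τ₀ (τ, w)))
      (fderiv ℝ (coords a τ₀) (τ, w) (1, 0)) < 0
  /-- The light cone `t² = x² + y² + z²` of the origin, with the origin, lies in `S`. -/
  cone_mem : ∀ x : R4, x 0 ^ 2 = x 1 ^ 2 + x 2 ^ 2 + x 3 ^ 2 → x ∈ S.carrier
  /-- The map `(t, x, y, z) ↦ (-t, -x, -y, -z)` maps `S` to itself … -/
  neg_mem : ∀ x ∈ S.carrier, -x ∈ S.carrier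
  /-- … and is an isometry. -/
  neg_isometry : ∀ x ∈ S.carrier, ∀ u v : R4, S.metric (-x) (-u) (-v) = S.metric x u v

end Milne

end

/-! Since `b' = b/a`, pulling the Minkowski metric back along `coords` gives `(b/a)²` times the
Milne-like metric (`mink_coordsDeriv`). Hence on the Milne-like spacetime, on its reflection and, by
continuity, on the light cone, `g` equals a positive function of `quad` times the Minkowski metric
(`metric_eq`, `conf_pos`). These points form `region`; the boost invariance of `g` there makes every
Lorentz transformation an isometry.

The causal set of the origin is exactly `region` (`causalSet_eq`). Straight segments to and from the
origin give one inclusion. For the other, a causal curve could leave in two ways. It cannot cross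
the light cone: outside it the metric is unknown, but it is Lipschitz and agrees on the cone with a
multiple of the Minkowski metric, so a Gronwall argument applies. It cannot cross a limiting
hyperboloid when `b` is bounded: a finite metric there would force `b` to grow linearly
(`sqrt_quad_mem_radii`). The causal past follows by reflection at the origin.

Conversely, let `F` be a causal isometry. It preserves the interior of `region`, by the inverse
function theorem. The curve of an observer at rest has unit speed, so by the reversed Cauchy–Schwarz
inequality cosmic time along its image changes at rate at least `1` in absolute value; as cosmic
time is positive, it must increase, and `F` does not decrease it (`cosmicTime_le`). The same holds
for the inverse, so `F` preserves `quad` (`quad_map`). The conformal factors now cancel, `F`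
preserves the Minkowski metric, and differentiating `quad ∘ F = quad` gives Euler's relation `dF_x x
= F x`. Thus `F (s x) = s F x` for `0 < s ≤ 1`, and letting `s → 0` identifies `F` with its
differential at the origin, which is a Lorentz matrix. -/

noncomputable section

namespace Milne

/-! ## Algebra of Minkowski space -/

/-- The Minkowski inner product on `ℝ⁴`. -/
def mink (u v : R4) : ℝ := -(u 0 * v 0) + u 1 * v 1 + u 2 * v 2 + u 3 * v 3

/-- The quadratic form `t² - x² - y² - z²`. -/
def quad (x : R4) : ℝ := x 0 ^ 2 - x 1 ^ 2 - x 2 ^ 2 - x 3 ^ 2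

/-- The vector `∂/∂t`. -/
def timeVec : R4 := ![1, 0, 0, 0]

lemma mink_self (x : R4) : mink x x = -quad x := by simp only [mink, quad]; ring

lemma mink_comm (u v : R4) : mink u v = mink v u := by simp only [mink]; ring

lemma mink_add_left (u v w : R4) : mink (u + v) w = mink u w + mink v w := by
  simp only [mink, Pi.add_apply]; ring

lemma mink_sub_left (u v w : R4) : mink (u - v) w = mink u w - mink v w := by
  simp only [mink, Pi.sub_apply]; ring

lemma mink_smul_left (c : ℝ) (u v : R4) : mink (c • u) v = c * mink u v := by
  simp only [mink, Pi.smul_apply, smul_eq_mul]; ring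

lemma mink_smul_right (c : ℝ) (u v : R4) : mink u (c • v) = c * mink u v := by
  simp only [mink, Pi.smul_apply, smul_eq_mul]; ring

lemma quad_smul (c : ℝ) (x : R4) : quad (c • x) = c ^ 2 * quad x := by
  simp only [quad, Pi.smul_apply, smul_eq_mul]; ring

lemma quad_neg (x : R4) : quad (-x) = quad x := by simp [quad]

lemma quad_zero : quad 0 = 0 := by simp [quad]

lemma quad_timeVec : quad timeVec = 1 := by simp [quad, timeVec]

lemma mink_timeVec_right (x : R4) : mink x timeVec = -x 0 := by simp [mink, timeVec]

lemma continuous_quad : Continuous quad := by unfold quad; fun_prop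

lemma contDiff_quad {n : WithTop ℕ∞} : ContDiff ℝ n quad := by
  unfold quad
  have h (i : Fin 4) : ContDiff ℝ n (fun x : R4 => x i) := contDiff_apply ℝ ℝ i
  exact ((((h 0).pow 2).sub ((h 1).pow 2)).sub ((h 2).pow 2)).sub ((h 3).pow 2)

lemma dotProduct_eta (u v : R4) : u ⬝ᵥ (eta *ᵥ v) = mink u v := by
  simp [eta, mink, dotProduct, Matrix.mulVec_diagonal, Fin.sum_univ_four]

lemma eq_zero_of_mink_eq_zero {u : R4} (h : ∀ v, mink u v = 0) : u = 0 := by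
  have h0 := h ![1, 0, 0, 0]
  have h1 := h ![0, 1, 0, 0]
  have h2 := h ![0, 0, 1, 0]
  have h3 := h ![0, 0, 0, 1]
  simp [mink] at h0 h1 h2 h3
  ext i
  fin_cases i <;> simpa

lemma sq_dot_le (x1 x2 x3 y1 y2 y3 : ℝ) : (x1 * y1 + x2 * y2 + x3 * y3) ^ 2 ≤
    (x1 ^ 2 + x2 ^ 2 + x3 ^ 2) * (y1 ^ 2 + y2 ^ 2 + y3 ^ 2) := by
  nlinarith [sq_nonneg (x1 * y2 - x2 * y1), sq_nonneg (x1 * y3 - x3 * y1),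
    sq_nonneg (x2 * y3 - x3 * y2)]

/-- Orthogonality equates the spatial dot product with `y 0 * z 0`; Cauchy–Schwarz and the bound of
the spatial part of `y` by `y 0` then allow `y 0 ^ 2` to be cancelled. -/
lemma mink_self_nonneg_of_orthogonal {y z : R4} (hy : 0 < quad y) (h : mink y z = 0) :
    0 ≤ mink z z := by
  simp only [mink, quad] at *
  have hcs := sq_dot_le (y 1) (y 2) (y 3) (z 1) (z 2) (z 3)
  have h' : y 1 * z 1 + y 2 * z 2 + y 3 * z 3 = y 0 * z 0 := by linarith
  rw [h'] at hcs
  have ht : 0 < y 0 ^ 2 := by nlinarith [sq_nonneg (y 1), sq_nonneg (y 2), sq_nonneg (y 3)]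
  have hz : 0 ≤ z 1 ^ 2 + z 2 ^ 2 + z 3 ^ 2 := by positivity
  have : y 0 ^ 2 * z 0 ^ 2 ≤ y 0 ^ 2 * (z 1 ^ 2 + z 2 ^ 2 + z 3 ^ 2) := by nlinarith
  have := le_of_mul_le_mul_left this ht
  nlinarith

/-- The reversed Cauchy–Schwarz inequality. -/
lemma quad_mul_quad_le {y : R4} (hy : 0 < quad y) (v : R4) :
    quad y * quad v ≤ mink y v ^ 2 := by
  -- This vector is `quad y` times the component of `v` orthogonal to `y`, and so is not timelike.
  have hz : mink y (quad y • v + mink y v • y) = 0 := by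
    rw [mink_comm, mink_add_left, mink_smul_left, mink_smul_left, mink_self, mink_comm v]; ring
  have h := mink_self_nonneg_of_orthogonal hy hz
  have e : mink (quad y • v + mink y v • y) (quad y • v + mink y v • y)
      = quad y * (mink y v ^ 2 - quad y * quad v) := by
    rw [mink_add_left, mink_smul_left, mink_smul_left, hz, mink_comm v, mink_add_left,
      mink_smul_left, mink_smul_left, mink_self, mink_comm y v]; ring
  rw [e] at h
  have := nonneg_of_mul_nonneg_right h hy
  linarith

lemma quad_nonneg_iff (x : R4) : 0 ≤ quad x ↔ x 1 ^ 2 + x 2 ^ 2 + x 3 ^ 2 ≤ x 0 ^ 2 := by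
  simp only [quad]; constructor <;> intro h <;> linarith

lemma apply_zero_ne_zero {x : R4} (h : 0 ≤ quad x) (hx : x ≠ 0) : x 0 ≠ 0 := by
  intro h0
  apply hx
  rw [quad_nonneg_iff, h0] at h
  have h1 : x 1 = 0 := by nlinarith [sq_nonneg (x 1), sq_nonneg (x 2), sq_nonneg (x 3)]
  have h2 : x 2 = 0 := by nlinarith [sq_nonneg (x 1), sq_nonneg (x 2), sq_nonneg (x 3)]
  have h3 : x 3 = 0 := by nlinarith [sq_nonneg (x 1), sq_nonneg (x 2), sq_nonneg (x 3)]
  ext i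
  fin_cases i <;> simpa

lemma apply_zero_ne_zero_of_quad_pos {x : R4} (h : 0 < quad x) : x 0 ≠ 0 :=
  apply_zero_ne_zero h.le (by rintro rfl; rw [quad_zero] at h; exact lt_irrefl _ h)

lemma mink_neg {y v : R4} (hy : 0 < quad y) (hy0 : 0 < y 0) (hv : 0 ≤ quad v) (hv0 : 0 < v 0) :
    mink y v < 0 := by
  simp only [mink, quad] at *
  have hcs := sq_dot_le (y 1) (y 2) (y 3) (v 1) (v 2) (v 3)
  have h1 : (y 1 * v 1 + y 2 * v 2 + y 3 * v 3) ^ 2 < (y 0 * v 0) ^ 2 := by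
    have hx : 0 ≤ y 1 ^ 2 + y 2 ^ 2 + y 3 ^ 2 := by positivity
    have hv2 : 0 < v 0 ^ 2 := by positivity
    calc _ ≤ _ := hcs
      _ ≤ (y 1 ^ 2 + y 2 ^ 2 + y 3 ^ 2) * v 0 ^ 2 := by
        apply mul_le_mul_of_nonneg_left _ hx; linarith
      _ < y 0 ^ 2 * v 0 ^ 2 := by apply mul_lt_mul_of_pos_right _ hv2; linarith
      _ = _ := by ring
  have := abs_lt_of_sq_lt_sq h1 (by positivity)
  linarith [(abs_lt.1 this).2]

lemma mink_mulVec_mulVec (A : Matrix (Fin 4) (Fin 4) ℝ) (u v : R4) :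
    mink (A *ᵥ u) (A *ᵥ v) = u ⬝ᵥ ((Aᵀ * eta * A) *ᵥ v) := by
  rw [← dotProduct_eta, ← Matrix.mulVec_mulVec, ← Matrix.mulVec_mulVec,
    Matrix.dotProduct_mulVec u Aᵀ, Matrix.vecMul_transpose]

/-- The Lorentz matrices preserve the Minkowski inner product. -/
lemma mink_mulVec {A : Matrix (Fin 4) (Fin 4) ℝ} (hA : Aᵀ * eta * A = eta) (u v : R4) :
    mink (A *ᵥ u) (A *ᵥ v) = mink u v := by
  rw [mink_mulVec_mulVec, hA, dotProduct_eta]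

/-- A linear map which preserves the Minkowski inner product is given by a Lorentz matrix. -/
lemma exists_lorentz {L : R4 →L[ℝ] R4} (hL : ∀ u v, mink (L u) (L v) = mink u v) :
    ∃ A : lorentzGroup, ∀ v, L v = ((A : GL (Fin 4) ℝ) : Matrix (Fin 4) (Fin 4) ℝ) *ᵥ v := by
  set M : Matrix (Fin 4) (Fin 4) ℝ := LinearMap.toMatrix' (L : R4 →ₗ[ℝ] R4) with hM
  have hLM (v : R4) : L v = M *ᵥ v := by
    rw [hM, LinearMap.toMatrix'_mulVec]; rfl
  have hMM : Mᵀ * eta * M = eta := by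
    ext i j
    have := mink_mulVec_mulVec M (Pi.single i 1) (Pi.single j 1)
    rw [← hLM, ← hLM, hL, ← dotProduct_eta] at this
    simpa using this.symm
  have hee : eta * eta = 1 := by
    rw [eta, Matrix.diagonal_mul_diagonal, ← Matrix.diagonal_one]
    congr 1
    ext i; fin_cases i <;> simp
  -- As `η² = 1`, the relation `Mᵀ η M = η` itself exhibits an inverse of `M`.
  have hinv : (eta * Mᵀ * eta) * M = 1 := by
    rw [Matrix.mul_assoc, Matrix.mul_assoc, ← Matrix.mul_assoc Mᵀ, hMM, hee]
  exact ⟨⟨⟨M, eta * Mᵀ * eta, mul_eq_one_comm.1 hinv, hinv⟩, hMM⟩, hLM⟩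

/-! ## The function `b` -/

section radius

variable {a : ℝ → ℝ} {τ₀ : ℝ}

lemma radius_pos (a : ℝ → ℝ) (τ₀ τ : ℝ) : 0 < radius a τ₀ τ := Real.exp_pos _

lemma hasDerivAt_radius (ha : IsScaleFactor a) (hτ₀ : 0 < τ₀) {τ : ℝ} (hτ : 0 < τ) :
    HasDerivAt (radius a τ₀) (radius a τ₀ τ / a τ) τ := by
  have hc : ContinuousOn (fun s => 1 / a s) (Ioi 0) :=
    continuousOn_const.div ha.continuousOn fun s hs => (ha.pos s hs).ne'
  have hsub : uIcc τ₀ τ ⊆ Ioi 0 := fun x hx => lt_of_lt_of_le (lt_min hτ₀ hτ) hx.1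
  have := (intervalIntegral.integral_hasDerivAt_right (hc.mono hsub).intervalIntegrable
    (hc.stronglyMeasurableAtFilter isOpen_Ioi τ hτ)
    (hc.continuousAt (Ioi_mem_nhds hτ))).exp
  unfold radius
  convert this using 1
  ring

lemma radius_strictMonoOn (ha : IsScaleFactor a) (hτ₀ : 0 < τ₀) :
    StrictMonoOn (radius a τ₀) (Ioi 0) := by
  apply strictMonoOn_of_deriv_pos (convex_Ioi 0)
  · exact fun τ hτ => (hasDerivAt_radius ha hτ₀ hτ).continuousAt.continuousWithinAt
  · intro τ hτ
    rw [interior_Ioi] at hτ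
    rw [(hasDerivAt_radius ha hτ₀ hτ).deriv]
    exact div_pos (radius_pos _ _ _) (ha.pos τ hτ)

/-- Near `0` the asymptotics give `a s ≤ 2 s`, so the logarithmic derivative `2/a - 1/s` of `b²/s`
is nonnegative. Hence `b² ≤ C s` for small `s`, and `b` tends to `0`. -/
lemma exists_radius_lt (ha : IsScaleFactor a) (hτ₀ : 0 < τ₀) {ρ : ℝ} (hρ : 0 < ρ) :
    ∃ τ, 0 < τ ∧ radius a τ₀ τ < ρ := by
  obtain ⟨ε, hε, ho⟩ := ha.asymp
  have h1 := ho.bound one_pos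
  obtain ⟨δ, hδ, hδ'⟩ := mem_nhdsGT_iff_exists_Ioo_subset.1
    (inter_mem h1 (Ioo_mem_nhdsGT (zero_lt_one' ℝ)))
  have hle : ∀ s ∈ Ioo 0 δ, a s ≤ 2 * s := by
    intro s hs
    obtain ⟨h2, h3⟩ := hδ' hs
    simp only [mem_ofPred_eq, Real.norm_eq_abs, one_mul] at h2
    rw [abs_of_nonneg (Real.rpow_nonneg hs.1.le _)] at h2
    have h4 : s ^ (1 + ε) ≤ s ^ (1 : ℝ) :=
      Real.rpow_le_rpow_of_exponent_ge h3.1 h3.2.le (by linarith)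
    rw [Real.rpow_one] at h4
    linarith [le_abs_self (a s - s)]
  have hd : ∀ s ∈ Ioo 0 δ, HasDerivAt (fun s => radius a τ₀ s ^ 2 / s)
      ((2 * radius a τ₀ s * (radius a τ₀ s / a s) * s - radius a τ₀ s ^ 2 * 1) / s ^ 2) s := by
    intro s hs
    refine (((hasDerivAt_radius ha hτ₀ hs.1).fun_pow 2).fun_div (hasDerivAt_id' s)
      hs.1.ne').congr_deriv ?_
    simp
  have hm : MonotoneOn (fun s => radius a τ₀ s ^ 2 / s) (Ioo 0 δ) := by
    apply monotoneOn_of_deriv_nonneg (convex_Ioo 0 δ)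
    · exact fun s hs => (hd s hs).continuousAt.continuousWithinAt
    · rw [interior_Ioo]
      exact fun s hs => (hd s hs).differentiableAt.differentiableWithinAt
    · rw [interior_Ioo]
      intro s hs
      rw [(hd s hs).deriv]
      apply div_nonneg _ (sq_nonneg _)
      have hap := ha.pos s hs.1
      have h5 : 1 ≤ 2 * s / a s := by rw [le_div_iff₀ hap, one_mul]; exact hle s hs
      have h6 : 2 * radius a τ₀ s * (radius a τ₀ s / a s) * s - radius a τ₀ s ^ 2 * 1
          = radius a τ₀ s ^ 2 * (2 * s / a s - 1) := by ring
      rw [h6]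
      exact mul_nonneg (sq_nonneg _) (by linarith)
  have hδ0 : 0 < δ := hδ
  set C := radius a τ₀ (δ / 2) ^ 2 / (δ / 2) with hC
  have hCpos : 0 < C := by have := radius_pos a τ₀ (δ / 2); positivity
  -- The first bound keeps the point where `b²/s ≤ C`; the second makes `C s ≤ ρ²/2`.
  refine ⟨min (δ / 2) (ρ ^ 2 / (2 * C)), by positivity, ?_⟩
  set s := min (δ / 2) (ρ ^ 2 / (2 * C)) with hs
  have hs0 : 0 < s := by positivity
  have h7 : radius a τ₀ s ^ 2 / s ≤ C :=
    hm ⟨hs0, lt_of_le_of_lt (min_le_left _ _) (by linarith)⟩ ⟨by linarith, by linarith⟩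
      (min_le_left _ _)
  rw [div_le_iff₀ hs0] at h7
  have h8 : C * s ≤ ρ ^ 2 / 2 := by
    calc C * s ≤ C * (ρ ^ 2 / (2 * C)) := by gcongr; exact min_le_right _ _
      _ = ρ ^ 2 / 2 := by field_simp
  apply lt_of_pow_lt_pow_left₀ 2 hρ.le
  have : 0 < ρ ^ 2 := by positivity
  linarith

/-- The values of the function `b`. -/
def radii (a : ℝ → ℝ) (τ₀ : ℝ) : Set ℝ := radius a τ₀ '' Ioi 0

lemma radii_pos {ρ : ℝ} (h : ρ ∈ radii a τ₀) : 0 < ρ := by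
  obtain ⟨τ, -, rfl⟩ := h
  exact radius_pos _ _ _

/-- As `b` is continuous with infimum `0`, the intermediate value theorem makes its image an
interval starting at `0`. The upper end may be finite. -/
lemma radii_of_le (ha : IsScaleFactor a) (hτ₀ : 0 < τ₀) {ρ ρ' : ℝ} (h : ρ ∈ radii a τ₀)
    (h0 : 0 < ρ') (hle : ρ' ≤ ρ) : ρ' ∈ radii a τ₀ := by
  obtain ⟨τ, hτ, rfl⟩ := h
  obtain ⟨τ', hτ', hlt⟩ := exists_radius_lt ha hτ₀ h0
  have hc : ContinuousOn (radius a τ₀) (uIcc τ' τ) := fun s hs =>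
    (hasDerivAt_radius ha hτ₀ (lt_of_lt_of_le (lt_min hτ' hτ) hs.1)).continuousAt.continuousWithinAt
  obtain ⟨s, hs, hs'⟩ := intermediate_value_uIcc hc
    (show ρ' ∈ uIcc (radius a τ₀ τ') (radius a τ₀ τ) from mem_uIcc_of_le hlt.le hle)
  exact ⟨s, lt_of_lt_of_le (lt_min hτ' hτ) hs.1, hs'⟩

lemma exists_radii_gt (ha : IsScaleFactor a) (hτ₀ : 0 < τ₀) {ρ : ℝ} (h : ρ ∈ radii a τ₀) :
    ∃ ρ' ∈ radii a τ₀, ρ < ρ' := by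
  obtain ⟨τ, hτ, rfl⟩ := h
  have hτ : 0 < τ := hτ
  exact ⟨_, mem_image_of_mem _ (show (0 : ℝ) < τ + 1 by linarith),
    radius_strictMonoOn ha hτ₀ hτ (show (0 : ℝ) < τ + 1 by linarith) (by linarith)⟩

lemma isOpen_radii (ha : IsScaleFactor a) (hτ₀ : 0 < τ₀) : IsOpen (radii a τ₀) := by
  rw [isOpen_iff_mem_nhds]
  intro ρ hρ
  obtain ⟨ρ', h', hlt⟩ := exists_radii_gt ha hτ₀ hρ
  filter_upwards [Ioo_mem_nhds (radii_pos hρ) hlt] with x hx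
  exact radii_of_le ha hτ₀ h' hx.1 hx.2.le

/-- The inverse function of `b`. -/
def cosmicTime (a : ℝ → ℝ) (τ₀ ρ : ℝ) : ℝ := Function.invFunOn (radius a τ₀) (Ioi 0) ρ

lemma cosmicTime_pos {ρ : ℝ} (h : ρ ∈ radii a τ₀) : 0 < cosmicTime a τ₀ ρ :=
  Function.invFunOn_mem h

lemma radius_cosmicTime {ρ : ℝ} (h : ρ ∈ radii a τ₀) : radius a τ₀ (cosmicTime a τ₀ ρ) = ρ :=
  Function.invFunOn_eq h

lemma cosmicTime_radius (ha : IsScaleFactor a) (hτ₀ : 0 < τ₀) {τ : ℝ} (hτ : 0 < τ) :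
    cosmicTime a τ₀ (radius a τ₀ τ) = τ :=
  (radius_strictMonoOn ha hτ₀).injOn (cosmicTime_pos ⟨τ, hτ, rfl⟩) hτ
    (radius_cosmicTime ⟨τ, hτ, rfl⟩)

lemma hasDerivAt_cosmicTime (ha : IsScaleFactor a) (hτ₀ : 0 < τ₀) {ρ : ℝ}
    (h : ρ ∈ radii a τ₀) :
    HasDerivAt (cosmicTime a τ₀) (a (cosmicTime a τ₀ ρ) / ρ) ρ := by
  obtain ⟨τ, hτ, rfl⟩ := h
  have hτ : 0 < τ := hτ
  rw [cosmicTime_radius ha hτ₀ hτ]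
  have hb := radius_pos a τ₀ τ
  have hap := ha.pos τ hτ
  have hs : HasStrictDerivAt (radius a τ₀) (radius a τ₀ τ / a τ) τ := by
    apply hasStrictDerivAt_of_hasDerivAt_of_continuousAt (f' := fun s => radius a τ₀ s / a s)
    · filter_upwards [Ioi_mem_nhds hτ] with s hs
      exact hasDerivAt_radius ha hτ₀ hs
    · exact (hasDerivAt_radius ha hτ₀ hτ).continuousAt.div
        (ha.continuousOn.continuousAt (Ioi_mem_nhds hτ)) hap.ne'
  have hne : radius a τ₀ τ / a τ ≠ 0 := (div_pos hb hap).ne'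
  have hl := (hs.to_localInverse hne).hasDerivAt
  have hval : hs.localInverse _ _ _ hne (radius a τ₀ τ) = τ :=
    HasStrictFDerivAt.localInverse_apply_image _
  -- Injectivity of `b` is known only on the positive half-line, so the local inverse must stay
  -- there to be identified with `cosmicTime`.
  have hpos : ∀ᶠ x in 𝓝 (radius a τ₀ τ), 0 < hs.localInverse _ _ _ hne x :=
    hl.continuousAt.eventually (by rw [hval]; exact Ioi_mem_nhds hτ)
  have heq : cosmicTime a τ₀ =ᶠ[𝓝 (radius a τ₀ τ)] hs.localInverse _ _ _ hne := by
    filter_upwards [hpos, hs.eventually_right_inverse hne] with x h1 h2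
    conv_lhs => rw [← h2]
    exact cosmicTime_radius ha hτ₀ h1
  have := hl.congr_of_eventuallyEq heq
  rwa [inv_div] at this

end radius

/-! ## The region swept out by the Milne-like spacetime and its reflection -/

section region

variable {a : ℝ → ℝ} {τ₀ : ℝ}

/-- The points of the Milne-like spacetime and of its reflection at the origin. -/
def innerRegion (a : ℝ → ℝ) (τ₀ : ℝ) : Set R4 :=
  {x | 0 < quad x ∧ √(quad x) ∈ radii a τ₀}

/-- The union of `innerRegion a τ₀` and of the light cone of the origin. -/
def region (a : ℝ → ℝ) (τ₀ : ℝ) : Set R4 :=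
  {x | 0 ≤ quad x ∧ (quad x = 0 ∨ √(quad x) ∈ radii a τ₀)}

lemma innerRegion_subset : innerRegion a τ₀ ⊆ region a τ₀ := fun _ h => ⟨h.1.le, Or.inr h.2⟩

lemma mem_innerRegion_of_pos {x : R4} (h : x ∈ region a τ₀) (hx : 0 < quad x) :
    x ∈ innerRegion a τ₀ := ⟨hx, h.2.resolve_left hx.ne'⟩

lemma mem_region_of_quad_eq {x y : R4} (h : quad y = quad x) (hx : x ∈ region a τ₀) :
    y ∈ region a τ₀ := by
  simpa only [region, mem_ofPred_eq, h] using hx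

lemma mem_innerRegion_of_quad_eq {x y : R4} (h : quad y = quad x) (hx : x ∈ innerRegion a τ₀) :
    y ∈ innerRegion a τ₀ := by
  simpa only [innerRegion, mem_ofPred_eq, h] using hx

lemma mem_region_of_quad_eq_zero {x : R4} (h : quad x = 0) : x ∈ region a τ₀ := ⟨h.ge, Or.inl h⟩

lemma zero_mem_region : (0 : R4) ∈ region a τ₀ := mem_region_of_quad_eq_zero quad_zero

lemma neg_mem_region {x : R4} (h : x ∈ region a τ₀) : -x ∈ region a τ₀ :=
  mem_region_of_quad_eq (quad_neg x) h

lemma isOpen_innerRegion (ha : IsScaleFactor a) (hτ₀ : 0 < τ₀) : IsOpen (innerRegion a τ₀) :=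
  (isOpen_lt continuous_const continuous_quad).inter
    ((isOpen_radii ha hτ₀).preimage continuous_quad.sqrt)

lemma smul_mem_innerRegion (ha : IsScaleFactor a) (hτ₀ : 0 < τ₀) {x : R4}
    (hx : x ∈ innerRegion a τ₀) {s : ℝ} (h0 : 0 < s) (h1 : s ≤ 1) :
    s • x ∈ innerRegion a τ₀ := by
  have h : √(quad (s • x)) = s * √(quad x) := by
    rw [quad_smul, Real.sqrt_mul (sq_nonneg s), Real.sqrt_sq h0.le]
  refine ⟨by rw [quad_smul]; exact mul_pos (by positivity) hx.1, ?_⟩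
  rw [h]
  have := radii_pos hx.2
  exact radii_of_le ha hτ₀ hx.2 (by positivity) (by nlinarith)

lemma smul_mem_region (ha : IsScaleFactor a) (hτ₀ : 0 < τ₀) {x : R4}
    (hx : x ∈ region a τ₀) {s : ℝ} (h0 : 0 ≤ s) (h1 : s ≤ 1) : s • x ∈ region a τ₀ := by
  rcases hx.1.eq_or_lt with h | h
  · exact mem_region_of_quad_eq_zero (by rw [quad_smul, ← h, mul_zero])
  rcases h0.eq_or_lt with rfl | h0
  · rw [zero_smul]; exact zero_mem_region
  exact innerRegion_subset (smul_mem_innerRegion ha hτ₀ (mem_innerRegion_of_pos hx h) h0 h1)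

lemma isPreconnected_region (ha : IsScaleFactor a) (hτ₀ : 0 < τ₀) :
    IsPreconnected (region a τ₀) := by
  have : StarConvex ℝ (0 : R4) (region a τ₀) := by
    rw [starConvex_zero_iff]
    exact fun x hx s h0 h1 => smul_mem_region ha hτ₀ hx h0 h1
  exact (this.isPathConnected zero_mem_region).isConnected.isPreconnected

/-- Near the light cone, a causal vector is in the region. -/
lemma eventually_mem_region (ha : IsScaleFactor a) (hτ₀ : 0 < τ₀) {x : R4} (hx : quad x = 0) :
    ∀ᶠ y in 𝓝 x, 0 ≤ quad y → y ∈ region a τ₀ := by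
  have hb := radius_pos a τ₀ τ₀
  have : ∀ᶠ y in 𝓝 x, quad y < radius a τ₀ τ₀ ^ 2 :=
    continuous_quad.continuousAt.eventually (gt_mem_nhds (by rw [hx]; positivity))
  filter_upwards [this] with y hy h0
  refine ⟨h0, ?_⟩
  rcases h0.eq_or_lt with h | h
  · exact Or.inl h.symm
  · refine Or.inr (radii_of_le ha hτ₀ ⟨τ₀, hτ₀, rfl⟩ (Real.sqrt_pos.2 h) ?_)
    rw [Real.sqrt_le_left hb.le]
    exact hy.le

lemma quad_add_smul_timeVec (x : R4) (s : ℝ) :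
    quad (x + s • timeVec) = quad x + 2 * s * x 0 + s ^ 2 := by
  simp only [quad, timeVec, Pi.add_apply, Pi.smul_apply, smul_eq_mul, cons_val_zero, cons_val_one,
    cons_val]
  ring

lemma tendsto_add_smul (x v : R4) : Tendsto (fun s : ℝ => x + s • v) (𝓝[>] 0) (𝓝 x) := by
  have : Tendsto (fun s : ℝ => x + s • v) (𝓝 0) (𝓝 (x + (0 : ℝ) • v)) :=
    Continuous.tendsto (by fun_prop) 0
  rw [zero_smul, add_zero] at this
  exact this.mono_left nhdsWithin_le_nhds

/-- The points of the light cone are limits of points of the inner region. -/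
lemma exists_eventually_add_smul_mem (ha : IsScaleFactor a) (hτ₀ : 0 < τ₀) {x : R4}
    (hx : quad x = 0) : ∃ v : R4, ∀ᶠ s : ℝ in 𝓝[>] 0, x + s • v ∈ innerRegion a τ₀ := by
  -- The sign `c` is that of `x 0`; moving along `c ∂/∂t` goes into the solid cone, even from the
  -- origin.
  have key (c : ℝ) (hc : c ^ 2 = 1) (hcx : 0 ≤ c * x 0) :
      ∀ᶠ s : ℝ in 𝓝[>] 0, x + s • (c • timeVec) ∈ innerRegion a τ₀ := by
    filter_upwards [(tendsto_add_smul x (c • timeVec)).eventually (eventually_mem_region ha hτ₀ hx),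
      self_mem_nhdsWithin] with s hs hs0
    have hs0 : 0 < s := hs0
    have hq : 0 < quad (x + s • (c • timeVec)) := by
      rw [smul_smul, quad_add_smul_timeVec, hx, mul_pow, hc]
      have : 0 ≤ s * (c * x 0) := by positivity
      nlinarith
    exact mem_innerRegion_of_pos (hs hq.le) hq
  rcases le_total 0 (x 0) with h | h
  · exact ⟨_, key 1 (by norm_num) (by linarith)⟩
  · exact ⟨_, key (-1) (by norm_num) (by linarith)⟩

/-- A nonzero point of the light cone is not interior: shrinking its time component in absolute
value makes `quad` negative. -/
lemma quad_pos_of_region_mem_nhds {x : R4} (h : region a τ₀ ∈ 𝓝 x) (hx : x ≠ 0) :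
    0 < quad x := by
  have hq : 0 ≤ quad x := (mem_of_mem_nhds h).1
  refine hq.lt_of_ne fun h0 => ?_
  have hx0 := apply_zero_ne_zero hq hx
  have ht := (tendsto_add_smul x ((-x 0) • timeVec)).eventually h
  obtain ⟨s, hs, hs0, hs1⟩ := (ht.and (Ioo_mem_nhdsGT (zero_lt_one' ℝ))).exists
  have := hs.1
  rw [smul_smul, quad_add_smul_timeVec, ← h0] at this
  have h2 : 0 < x 0 ^ 2 := by positivity
  have h3 : 0 < x 0 ^ 2 * s * (2 - s) := by
    have : 0 < 2 - s := by linarith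
    positivity
  nlinarith

end region

/-! ## The coordinates of the Milne-like spacetime -/

section coords

variable {a : ℝ → ℝ} {τ₀ : ℝ}

lemma coords_zero (τ : ℝ) (w : R3) :
    coords a τ₀ (τ, w) 0 = radius a τ₀ τ * √(1 + w ⬝ᵥ w) := by simp [coords]

lemma coords_succ (τ : ℝ) (w : R3) (i : Fin 3) :
    coords a τ₀ (τ, w) i.succ = radius a τ₀ τ * w i := by simp [coords]

/-- The differential of `coords`. -/
def coordsDeriv (a : ℝ → ℝ) (τ₀ τ : ℝ) (w : R3) (u : ℝ × R3) : R4 :=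
  Fin.cons (radius a τ₀ τ / a τ * u.1 * √(1 + w ⬝ᵥ w)
      + radius a τ₀ τ * (w ⬝ᵥ u.2 / √(1 + w ⬝ᵥ w)))
    (fun i => radius a τ₀ τ / a τ * u.1 * w i + radius a τ₀ τ * u.2 i)

lemma one_add_dotProduct_self_pos (w : R3) : 0 < 1 + w ⬝ᵥ w := by
  have : 0 ≤ w ⬝ᵥ w := by
    simp only [dotProduct, Fin.sum_univ_three]
    nlinarith [mul_self_nonneg (w 0), mul_self_nonneg (w 1), mul_self_nonneg (w 2)]
  linarith

lemma fderiv_coords (ha : IsScaleFactor a) (hτ₀ : 0 < τ₀) {τ : ℝ} (hτ : 0 < τ) (w : R3)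
    (u : ℝ × R3) : fderiv ℝ (coords a τ₀) (τ, w) u = coordsDeriv a τ₀ τ w u := by
  have hq := one_add_dotProduct_self_pos w
  have hb := hasDerivAt_radius ha hτ₀ hτ
  have hd : DifferentiableAt ℝ (coords a τ₀) (τ, w) := by
    have h1 : DifferentiableAt ℝ (fun p : ℝ × R3 => radius a τ₀ p.1) (τ, w) :=
      DifferentiableAt.comp (g := radius a τ₀) (τ, w) hb.differentiableAt differentiableAt_fst
    have h2 : DifferentiableAt ℝ (fun p : ℝ × R3 => √(1 + p.2 ⬝ᵥ p.2)) (τ, w) := by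
      have h : DifferentiableAt ℝ (fun p : ℝ × R3 => 1 + p.2 ⬝ᵥ p.2) (τ, w) := by
        simp only [dotProduct, Fin.sum_univ_three]
        fun_prop
      exact h.sqrt hq.ne'
    rw [differentiableAt_pi]
    refine Fin.cases ?_ fun i => ?_
    · simpa [coords] using h1.fun_mul h2
    · have h3 : DifferentiableAt ℝ (fun p : ℝ × R3 => p.2 i) (τ, w) := by fun_prop
      simpa [coords] using h1.fun_mul h3
  have hl : HasDerivAt (fun s : ℝ => (τ + s * u.1, w + s • u.2)) u 0 := by
    have h1 : HasDerivAt (fun s : ℝ => τ + s * u.1) u.1 0 := by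
      simpa using ((hasDerivAt_id' (0 : ℝ)).mul_const u.1).const_add τ
    have h2 : HasDerivAt (fun s : ℝ => w + s • u.2) u.2 0 := by
      simpa using ((hasDerivAt_id' (0 : ℝ)).smul_const u.2).const_add w
    exact h1.prodMk h2
  have hcomp : HasDerivAt (fun s : ℝ => coords a τ₀ (τ + s * u.1, w + s • u.2))
      (fderiv ℝ (coords a τ₀) (τ, w) u) 0 := by
    have hf : HasFDerivAt (coords a τ₀) (fderiv ℝ (coords a τ₀) (τ, w))
        (τ + 0 * u.1, w + (0 : ℝ) • u.2) := by simpa using hd.hasFDerivAt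
    exact hf.comp_hasDerivAt 0 hl
  refine hcomp.unique ?_
  have hb' : HasDerivAt (fun s : ℝ => radius a τ₀ (τ + s * u.1))
      (radius a τ₀ τ / a τ * u.1) 0 := by
    have h0 : HasDerivAt (radius a τ₀) (radius a τ₀ τ / a τ) (τ + 0 * u.1) := by simpa using hb
    have h1 : HasDerivAt (fun s : ℝ => τ + s * u.1) u.1 0 := by
      simpa using ((hasDerivAt_id' (0 : ℝ)).mul_const u.1).const_add τ
    exact HasDerivAt.comp (h₂ := radius a τ₀) 0 h0 h1
  have hw (i : Fin 3) : HasDerivAt (fun s : ℝ => w i + s * u.2 i) (u.2 i) 0 := by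
    simpa using ((hasDerivAt_id' (0 : ℝ)).mul_const (u.2 i)).const_add (w i)
  rw [hasDerivAt_pi]
  refine Fin.cases ?_ fun i => ?_
  · have h1 : HasDerivAt (fun s : ℝ => 1 + (w + s • u.2) ⬝ᵥ (w + s • u.2)) (2 * (w ⬝ᵥ u.2)) 0 := by
      simp only [dotProduct, Fin.sum_univ_three, Pi.add_apply, Pi.smul_apply, smul_eq_mul]
      refine (((((hw 0).fun_mul (hw 0)).fun_add ((hw 1).fun_mul (hw 1))).fun_add
        ((hw 2).fun_mul (hw 2))).const_add 1).congr_deriv ?_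
      ring
    have h2 := hb'.fun_mul (h1.sqrt (by simpa using hq.ne'))
    simp only [coords_zero, coordsDeriv, Fin.cons_zero]
    refine h2.congr_deriv ?_
    simp only [zero_smul, add_zero, zero_mul]
    congr 2
    rw [mul_div_mul_left _ _ two_ne_zero]
  · have h2 := hb'.fun_mul (hw i)
    simp only [coords_succ, coordsDeriv, Fin.cons_succ, Pi.add_apply, Pi.smul_apply, smul_eq_mul]
    refine h2.congr_deriv ?_
    simp

/-- In polar form the Minkowski metric is `-db² + b² h`, and `db = (b/a) dτ` turns it into `(b/a)²
(-dτ² + a² h)`. This is the reason for the choice of `b`. -/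
lemma mink_coordsDeriv (ha : IsScaleFactor a) {τ : ℝ} (hτ : 0 < τ) (w : R3) (u v : ℝ × R3) :
    mink (coordsDeriv a τ₀ τ w u) (coordsDeriv a τ₀ τ w v)
      = (radius a τ₀ τ / a τ) ^ 2 * milneMetric a (τ, w) u v := by
  have hq := one_add_dotProduct_self_pos w
  have ha' := ha.pos τ hτ
  have hs := Real.sq_sqrt hq.le
  have hs0 := Real.sqrt_pos.2 hq
  simp only [mink, milneMetric, hyperbolicMetric, coordsDeriv]
  rw [show (1 : Fin 4) = Fin.succ 0 from rfl, show (2 : Fin 4) = Fin.succ 1 from rfl,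
    show (3 : Fin 4) = Fin.succ 2 from rfl]
  simp only [Fin.cons_zero, Fin.cons_succ]
  set q := √(1 + w ⬝ᵥ w)
  rw [← hs]
  have hs' : w 0 * w 0 + w 1 * w 1 + w 2 * w 2 = q ^ 2 - 1 := by
    rw [hs]; simp [dotProduct, Fin.sum_univ_three]
  simp only [dotProduct, Fin.sum_univ_three]
  field_simp
  linear_combination (radius a τ₀ τ ^ 2 * u.1 * v.1 * q ^ 2) * hs'

lemma exists_coordsDeriv_eq (ha : IsScaleFactor a) {τ : ℝ} (hτ : 0 < τ) (w : R3) (X : R4) :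
    ∃ u, coordsDeriv a τ₀ τ w u = X := by
  have hq := one_add_dotProduct_self_pos w
  have ha' := ha.pos τ hτ
  have hb := radius_pos a τ₀ τ
  have hs := Real.sq_sqrt hq.le
  have hs0 := Real.sqrt_pos.2 hq
  set q := √(1 + w ⬝ᵥ w) with hqdef
  have hs' : w 0 * w 0 + w 1 * w 1 + w 2 * w 2 = q ^ 2 - 1 := by
    rw [hs]; simp [dotProduct, Fin.sum_univ_three]
  -- The component of `X` along the unit timelike vector `(q, w)`, that is, along `∂/∂τ`; the
  -- spatial components then determine the rest of the preimage.
  set m := X 0 * q - (X 1 * w 0 + X 2 * w 1 + X 3 * w 2) with hm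
  refine ⟨(a τ / radius a τ₀ τ * m, fun i => (X i.succ - m * w i) / radius a τ₀ τ), ?_⟩
  funext i
  refine Fin.cases ?_ (fun i => ?_) i
  · simp only [coordsDeriv, Fin.cons_zero]
    rw [← hqdef]
    simp only [dotProduct, Fin.sum_univ_three]
    rw [show (0 : Fin 3).succ = 1 from rfl, show (1 : Fin 3).succ = 2 from rfl,
      show (2 : Fin 3).succ = 3 from rfl]
    field_simp
    linear_combination -m * hs' + hm
  · simp only [coordsDeriv, Fin.cons_succ]
    field_simp
    ring

/-- The points of the inner region with positive time are points of the Milne-like spacetime. -/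
lemma exists_coords_eq {x : R4} (hx : x ∈ innerRegion a τ₀) (h0 : 0 < x 0) :
    ∃ w, coords a τ₀ (cosmicTime a τ₀ √(quad x), w) = x := by
  set ρ := √(quad x) with hρ
  have hρ0 : 0 < ρ := Real.sqrt_pos.2 hx.1
  have hρ2 : ρ ^ 2 = quad x := Real.sq_sqrt hx.1.le
  refine ⟨fun i => x i.succ / ρ, ?_⟩
  have hr : radius a τ₀ (cosmicTime a τ₀ ρ) = ρ := radius_cosmicTime hx.2
  funext i
  refine Fin.cases ?_ (fun i => ?_) i
  · rw [coords_zero, hr]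
    have : 1 + (fun i : Fin 3 => x i.succ / ρ) ⬝ᵥ (fun i => x i.succ / ρ) = (x 0 / ρ) ^ 2 := by
      simp only [dotProduct, Fin.sum_univ_three]
      rw [show (0 : Fin 3).succ = 1 from rfl, show (1 : Fin 3).succ = 2 from rfl,
        show (2 : Fin 3).succ = 3 from rfl]
      field_simp
      rw [hρ2, quad]; ring
    rw [this, Real.sqrt_sq (by positivity)]
    field_simp
  · rw [coords_succ, hr]
    field_simp

end coords

/-! ## The metric of a PT extension on the region -/

lemma CoordSpacetime.continuousAt_metric (S : CoordSpacetime) {p : R4} (hp : p ∈ S.carrier)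
    (u v : R4) : ContinuousAt (fun q => S.metric q u v) p := by
  have h : ContinuousAt S.metric p :=
    S.contDiffOn_metric.continuousOn.continuousAt (S.isOpen_carrier.mem_nhds hp)
  exact (h.clm_apply continuousAt_const).clm_apply continuousAt_const

/-- The conformal factor of a PT extension, as a function of the Minkowski distance from
the origin. -/
def CoordSpacetime.conf (S : CoordSpacetime) (ρ : ℝ) : ℝ :=
  -S.metric (ρ • timeVec) timeVec timeVec

section

variable {a : ℝ → ℝ} {τ₀ : ℝ} {S : CoordSpacetime}

lemma quad_eq_zero_iff (x : R4) : quad x = 0 ↔ x 0 ^ 2 = x 1 ^ 2 + x 2 ^ 2 + x 3 ^ 2 := by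
  simp only [quad]; constructor <;> intro h <;> linarith

namespace IsPTExtension

lemma zero_mem (hS : IsPTExtension a τ₀ S) : (0 : R4) ∈ S.carrier := hS.cone_mem 0 (by simp)

lemma innerRegion_subset_carrier (hS : IsPTExtension a τ₀ S) : innerRegion a τ₀ ⊆ S.carrier := by
  have key : ∀ x ∈ innerRegion a τ₀, 0 < x 0 → x ∈ S.carrier := by
    intro x hx h0
    obtain ⟨w, hw⟩ := exists_coords_eq hx h0
    rw [← hw]
    exact hS.coords_mem _ w (cosmicTime_pos hx.2)
  intro x hx
  rcases lt_or_gt_of_ne (apply_zero_ne_zero_of_quad_pos hx.1) with h | h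
  · rw [← neg_neg x]
    exact hS.neg_mem _ (key (-x) (mem_innerRegion_of_quad_eq (quad_neg x) hx)
      (by simpa using h))
  · exact key x hx h

lemma region_subset_carrier (hS : IsPTExtension a τ₀ S) : region a τ₀ ⊆ S.carrier := by
  intro x hx
  rcases hx.1.eq_or_lt with h | h
  · exact hS.cone_mem x ((quad_eq_zero_iff x).1 h.symm)
  · exact hS.innerRegion_subset_carrier (mem_innerRegion_of_pos hx h)

lemma metric_coords (ha : IsScaleFactor a) (hτ₀ : 0 < τ₀) (hS : IsPTExtension a τ₀ S) {τ : ℝ}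
    (hτ : 0 < τ) (w : R3) (X Y : R4) :
    S.metric (coords a τ₀ (τ, w)) X Y = (a τ / radius a τ₀ τ) ^ 2 * mink X Y := by
  obtain ⟨u, rfl⟩ := exists_coordsDeriv_eq (τ₀ := τ₀) ha hτ w X
  obtain ⟨v, rfl⟩ := exists_coordsDeriv_eq (τ₀ := τ₀) ha hτ w Y
  have h := hS.isometric τ w hτ u v
  rw [fderiv_coords ha hτ₀ hτ, fderiv_coords ha hτ₀ hτ] at h
  rw [h, mink_coordsDeriv ha hτ]
  have := ha.pos τ hτ
  have := radius_pos a τ₀ τ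
  field_simp

lemma metric_eq_of_mem_innerRegion (ha : IsScaleFactor a) (hτ₀ : 0 < τ₀)
    (hS : IsPTExtension a τ₀ S) {x : R4} (hx : x ∈ innerRegion a τ₀) (X Y : R4) :
    S.metric x X Y = (a (cosmicTime a τ₀ √(quad x)) / √(quad x)) ^ 2 * mink X Y := by
  have key : ∀ x ∈ innerRegion a τ₀, 0 < x 0 → ∀ X Y,
      S.metric x X Y = (a (cosmicTime a τ₀ √(quad x)) / √(quad x)) ^ 2 * mink X Y := by
    intro x hx h0 X Y
    obtain ⟨w, hw⟩ := exists_coords_eq hx h0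
    conv_lhs => rw [← hw]
    rw [hS.metric_coords ha hτ₀ (cosmicTime_pos hx.2), radius_cosmicTime hx.2]
  rcases lt_or_gt_of_ne (apply_zero_ne_zero_of_quad_pos hx.1) with h | h
  · rw [← hS.neg_isometry x (hS.innerRegion_subset_carrier hx),
      key (-x) (mem_innerRegion_of_quad_eq (quad_neg x) hx) (by simpa using h), quad_neg]
    simp [mink]
  · exact key x hx h X Y

lemma smul_timeVec_mem {ρ : ℝ} (hρ : ρ ∈ radii a τ₀) : ρ • timeVec ∈ innerRegion a τ₀ := by
  have h := radii_pos hρ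
  have : quad (ρ • timeVec) = ρ ^ 2 := by rw [quad_smul, quad_timeVec, mul_one]
  refine ⟨by rw [this]; positivity, ?_⟩
  rw [this, Real.sqrt_sq h.le]
  exact hρ

lemma conf_eq (ha : IsScaleFactor a) (hτ₀ : 0 < τ₀) (hS : IsPTExtension a τ₀ S) {ρ : ℝ}
    (hρ : ρ ∈ radii a τ₀) : S.conf ρ = (a (cosmicTime a τ₀ ρ) / ρ) ^ 2 := by
  have h := radii_pos hρ
  rw [CoordSpacetime.conf, hS.metric_eq_of_mem_innerRegion ha hτ₀ (smul_timeVec_mem hρ),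
    quad_smul, quad_timeVec, mul_one, Real.sqrt_sq h.le, mink_self, quad_timeVec]
  ring

lemma conf_pos_of_mem (ha : IsScaleFactor a) (hτ₀ : 0 < τ₀) (hS : IsPTExtension a τ₀ S) {ρ : ℝ}
    (hρ : ρ ∈ radii a τ₀) : 0 < S.conf ρ := by
  rw [hS.conf_eq ha hτ₀ hρ]
  have := radii_pos hρ
  have := ha.pos _ (cosmicTime_pos hρ)
  positivity

/-- Reading the conformal factor off the metric on the time axis gives continuity at `0` for free;
the expression `(a/b)²` is available only for radii in the image of `b`. -/
lemma continuousAt_conf_zero (hS : IsPTExtension a τ₀ S) : ContinuousAt S.conf 0 := by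
  have h1 : ContinuousAt (fun q => S.metric q timeVec timeVec) ((0 : ℝ) • timeVec) := by
    rw [zero_smul]; exact S.continuousAt_metric hS.zero_mem _ _
  have h2 : ContinuousAt (fun ρ : ℝ => ρ • timeVec) 0 := by fun_prop
  exact (ContinuousAt.comp (f := fun ρ : ℝ => ρ • timeVec) h1 h2).neg

/-- On the region, the metric is conformal to the Minkowski metric. -/
lemma metric_eq (ha : IsScaleFactor a) (hτ₀ : 0 < τ₀) (hS : IsPTExtension a τ₀ S) {x : R4}
    (hx : x ∈ region a τ₀) (X Y : R4) :
    S.metric x X Y = S.conf √(quad x) * mink X Y := by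
  rcases hx.1.eq_or_lt with h | h
  · rw [← h, Real.sqrt_zero]
    -- On the cone, both sides are limits along a segment that enters the inner region.
    obtain ⟨v, hv⟩ := exists_eventually_add_smul_mem ha hτ₀ h.symm
    have hc := S.continuousAt_metric (hS.region_subset_carrier hx) X Y
    have h1 := hc.tendsto.comp (tendsto_add_smul x v)
    have h2 : Tendsto (fun s : ℝ => √(quad (x + s • v))) (𝓝[>] 0) (𝓝 0) := by
      have := (continuous_quad.sqrt.tendsto x).comp (tendsto_add_smul x v)
      rwa [← h, Real.sqrt_zero] at this
    have h3 := ((hS.continuousAt_conf_zero.tendsto.comp h2).mul_const (mink X Y))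
    refine tendsto_nhds_unique h1 (h3.congr' ?_)
    filter_upwards [hv] with s hs
    simp only [Function.comp_apply]
    rw [hS.metric_eq_of_mem_innerRegion ha hτ₀ hs, hS.conf_eq ha hτ₀ hs.2]
  · have hi := mem_innerRegion_of_pos hx h
    rw [hS.metric_eq_of_mem_innerRegion ha hτ₀ hi, hS.conf_eq ha hτ₀ hi.2]

/-- A limit of positive factors is nonnegative, and the value `0` would make the metric vanish at
the origin, against its signature. -/
lemma conf_zero_pos (ha : IsScaleFactor a) (hτ₀ : 0 < τ₀) (hS : IsPTExtension a τ₀ S) :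
    0 < S.conf 0 := by
  have hne : S.conf 0 ≠ 0 := by
    intro h
    obtain ⟨e, he⟩ := S.lorentzian 0 hS.zero_mem
    have h1 := he 1 1
    rw [hS.metric_eq ha hτ₀ zero_mem_region, quad_zero, Real.sqrt_zero, h] at h1
    simp [eta] at h1
  have h0 : Tendsto S.conf (𝓝[>] 0) (𝓝 (S.conf 0)) :=
    hS.continuousAt_conf_zero.tendsto.mono_left nhdsWithin_le_nhds
  have hge : 0 ≤ S.conf 0 := by
    refine ge_of_tendsto h0 ?_
    filter_upwards [Ioc_mem_nhdsGT (radius_pos a τ₀ τ₀)] with ρ hρ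
    exact (hS.conf_pos_of_mem ha hτ₀ (radii_of_le ha hτ₀ ⟨τ₀, hτ₀, rfl⟩ hρ.1 hρ.2)).le
  exact hge.lt_of_ne hne.symm

lemma conf_pos (ha : IsScaleFactor a) (hτ₀ : 0 < τ₀) (hS : IsPTExtension a τ₀ S) {x : R4}
    (hx : x ∈ region a τ₀) : 0 < S.conf √(quad x) := by
  rcases hx.2 with h | h
  · rw [h, Real.sqrt_zero]; exact hS.conf_zero_pos ha hτ₀
  · exact hS.conf_pos_of_mem ha hτ₀ h

/-- On the region, the time orientation is the one of Minkowski space. -/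
lemma timeField_apply_zero_pos (ha : IsScaleFactor a) (hτ₀ : 0 < τ₀) (hS : IsPTExtension a τ₀ S)
    {x : R4} (hx : x ∈ region a τ₀) : 0 < S.timeField x 0 := by
  have hq (y) (hy : y ∈ region a τ₀) : 0 < quad (S.timeField y) := by
    have h := S.timeField_timelike y (hS.region_subset_carrier hy)
    rw [hS.metric_eq ha hτ₀ hy, mink_self] at h
    have := hS.conf_pos ha hτ₀ hy
    nlinarith
  -- A timelike vector has nonzero time component, so on the connected region the sign is constant;
  -- it is found at one point of the time axis, where `∂/∂τ` is future directed.
  have hne (y) (hy : y ∈ region a τ₀) : S.timeField y 0 ≠ 0 :=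
    apply_zero_ne_zero_of_quad_pos (hq y hy)
  have hcont : ContinuousOn (fun y => S.timeField y 0) (region a τ₀) :=
    (continuous_apply 0).comp_continuousOn
      (S.continuousOn_timeField.mono hS.region_subset_carrier)
  have hbase : radius a τ₀ τ₀ • timeVec ∈ region a τ₀ :=
    innerRegion_subset (smul_timeVec_mem ⟨τ₀, hτ₀, rfl⟩)
  have h0 : 0 < S.timeField (radius a τ₀ τ₀ • timeVec) 0 := by
    have hc : coords a τ₀ (τ₀, 0) = radius a τ₀ τ₀ • timeVec := by
      rw [coords]
      congr 1
      ext i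
      fin_cases i <;> simp [timeVec] <;> rfl
    have hd : coordsDeriv a τ₀ τ₀ 0 (1, 0) = (radius a τ₀ τ₀ / a τ₀) • timeVec := by
      ext i
      fin_cases i <;> simp [timeVec, coordsDeriv] <;> rfl
    have h := hS.future τ₀ 0 hτ₀
    rw [fderiv_coords ha hτ₀ hτ₀, hd, hc, hS.metric_eq ha hτ₀ hbase, mink_smul_right,
      mink_timeVec_right] at h
    have h1 := hS.conf_pos ha hτ₀ hbase
    have h2 : 0 < radius a τ₀ τ₀ / a τ₀ := div_pos (radius_pos _ _ _) (ha.pos _ hτ₀)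
    have h3 := mul_pos h1 h2
    nlinarith
  by_contra hle
  push Not at hle
  obtain ⟨y, hy, hy0⟩ := (isPreconnected_region ha hτ₀).intermediate_value hx hbase hcont
    ⟨hle, h0.le⟩
  exact hne y hy hy0

/-- A positive conformal factor does not change the light cones, and the time field lies in the
future Minkowski cone. -/
lemma isFutureCausal_iff (ha : IsScaleFactor a) (hτ₀ : 0 < τ₀) (hS : IsPTExtension a τ₀ S)
    {x : R4} (hx : x ∈ region a τ₀) (v : R4) :
    S.IsFutureCausal x v ↔ 0 ≤ quad v ∧ 0 < v 0 := by
  have hc := hS.conf_pos ha hτ₀ hx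
  have hT0 := hS.timeField_apply_zero_pos ha hτ₀ hx
  have hT : 0 < quad (S.timeField x) := by
    have h := S.timeField_timelike x (hS.region_subset_carrier hx)
    rw [hS.metric_eq ha hτ₀ hx, mink_self] at h
    nlinarith
  rw [CoordSpacetime.IsFutureCausal, hS.metric_eq ha hτ₀ hx, hS.metric_eq ha hτ₀ hx, mink_self]
  constructor
  · rintro ⟨hv, h1, h2⟩
    have hq : 0 ≤ quad v := by
      by_contra h
      push Not at h
      nlinarith
    refine ⟨hq, ?_⟩
    rcases lt_or_gt_of_ne (apply_zero_ne_zero hq hv) with h | h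
    · have h3 := mink_neg hT hT0 (v := -v) (by rwa [quad_neg]) (by simpa using h)
      have h4 : mink (S.timeField x) (-v) = -mink (S.timeField x) v := by
        simp only [mink, Pi.neg_apply]; ring
      rw [h4] at h3
      nlinarith
    · exact h
  · rintro ⟨hq, h0⟩
    refine ⟨by rintro rfl; simp at h0, by nlinarith, ?_⟩
    exact mul_neg_of_pos_of_neg hc (mink_neg hT hT0 hq h0)

/-- If the function `b` is bounded, then the hyperboloids given by its supremum do not
meet the spacetime. -/
lemma sqrt_quad_mem_radii (ha : IsScaleFactor a) (hτ₀ : 0 < τ₀) (hS : IsPTExtension a τ₀ S)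
    {x : R4} (hx : x ∈ S.carrier) (hq : 0 < quad x)
    (hlt : ∀ ρ, 0 < ρ → ρ < √(quad x) → ρ ∈ radii a τ₀) : √(quad x) ∈ radii a τ₀ := by
  set r := √(quad x) with hr
  have hr0 : 0 < r := Real.sqrt_pos.2 hq
  by_contra hn
  have hbd : ∀ τ, 0 < τ → radius a τ₀ τ < r := by
    intro τ hτ
    by_contra h
    push Not at h
    exact hn (radii_of_le ha hτ₀ ⟨τ, hτ, rfl⟩ hr0 h)
  -- the conformal factor is bounded near `r`
  have hb : ∀ᶠ y in 𝓝 x, |S.metric y x x| < |S.metric x x x| + 1 :=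
    (S.continuousAt_metric hx x x).abs.eventually (gt_mem_nhds (lt_add_one _))
  have ht : Tendsto (fun ρ : ℝ => (ρ / r) • x) (𝓝 r) (𝓝 x) := by
    have : Tendsto (fun ρ : ℝ => (ρ / r) • x) (𝓝 r) (𝓝 ((r / r) • x)) :=
      Continuous.tendsto (by fun_prop) r
    rwa [div_self hr0.ne', one_smul] at this
  set C := (|S.metric x x x| + 1) / quad x with hC
  have hCpos : 0 < C := by positivity
  obtain ⟨l, hl, hl'⟩ := (mem_nhdsLT_iff_exists_Ioo_subset' hr0).1
    (show {ρ | |S.metric ((ρ / r) • x) x x| < |S.metric x x x| + 1} ∈ 𝓝[<] r from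
      mem_nhdsWithin_of_mem_nhds (ht.eventually hb))
  have hconf : ∀ ρ, 0 < ρ → l < ρ → ρ < r → (a (cosmicTime a τ₀ ρ) / ρ) ^ 2 ≤ C := by
    intro ρ hρ0 hlρ hρr
    have hs : quad ((ρ / r) • x) = ρ ^ 2 := by
      rw [quad_smul, ← Real.sq_sqrt hq.le, ← hr]; field_simp
    have hm : (ρ / r) • x ∈ innerRegion a τ₀ := by
      refine ⟨by rw [hs]; positivity, ?_⟩
      rw [hs, Real.sqrt_sq hρ0.le]
      exact hlt ρ hρ0 hρr
    have h1 : |S.metric ((ρ / r) • x) x x| < |S.metric x x x| + 1 := hl' ⟨hlρ, hρr⟩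
    rw [hS.metric_eq_of_mem_innerRegion ha hτ₀ hm, hs, Real.sqrt_sq hρ0.le, mink_self, abs_mul,
      abs_neg, abs_of_pos hq, abs_of_nonneg (sq_nonneg _)] at h1
    rw [hC, le_div_iff₀ hq]
    exact h1.le
  -- hence the derivative of `b` is bounded below
  set m := max l (r / 2) with hm
  have hmr : m < r := max_lt hl (by linarith)
  have hm0 : 0 < m := lt_of_lt_of_le (by linarith) (le_max_right _ _)
  set τ₁ := cosmicTime a τ₀ m with hτ₁
  have hm_mem := hlt m hm0 hmr
  have hτ₁0 : 0 < τ₁ := cosmicTime_pos hm_mem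
  have hD : ∀ τ, τ₁ < τ → (√C)⁻¹ ≤ radius a τ₀ τ / a τ := by
    intro τ hτ
    have hτ0 : 0 < τ := hτ₁0.trans hτ
    have h1 : m < radius a τ₀ τ := by
      rw [← radius_cosmicTime hm_mem]
      exact radius_strictMonoOn ha hτ₀ hτ₁0 hτ0 hτ
    have h2 := hconf (radius a τ₀ τ) (radius_pos _ _ _) ((le_max_left _ _).trans_lt h1) (hbd τ hτ0)
    rw [cosmicTime_radius ha hτ₀ hτ0] at h2
    have h3 := ha.pos τ hτ0
    have h4 := radius_pos a τ₀ τ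
    have h5 : a τ / radius a τ₀ τ ≤ √C := Real.le_sqrt_of_sq_le h2
    rw [← inv_div]
    exact inv_anti₀ (by positivity) h5
  have hgrow := (convex_Ici τ₁).mul_sub_le_image_sub_of_le_deriv (f := radius a τ₀)
    (C := (√C)⁻¹)
    (fun τ hτ => (hasDerivAt_radius ha hτ₀ (hτ₁0.trans_le hτ)).continuousAt.continuousWithinAt)
    (by
      rw [interior_Ici]
      exact fun τ hτ => (hasDerivAt_radius ha hτ₀
        (hτ₁0.trans hτ)).differentiableAt.differentiableWithinAt)
    (by
      rw [interior_Ici]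
      intro τ hτ
      rw [(hasDerivAt_radius ha hτ₀ (hτ₁0.trans hτ)).deriv]
      exact hD τ hτ)
  have hsC : 0 < √C := Real.sqrt_pos.2 hCpos
  -- With slope at least `1/√C`, a time lapse of `√C * r` lets `b` grow by `r`, beyond its supposed
  -- bound.
  have h1 := hgrow τ₁ self_mem_Ici (τ₁ + √C * r) (by simp; positivity) (by
    have : 0 < √C * r := by positivity
    linarith)
  have h2 := hbd (τ₁ + √C * r) (by positivity)
  have h3 := radius_pos a τ₀ τ₁
  rw [add_sub_cancel_left, inv_mul_cancel_left₀ hsC.ne'] at h1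
  linarith

end IsPTExtension

end

/-! ## Causal curves do not leave the region through the light cone -/

/-- The spatial part of a vector. -/
def spatial : R4 →L[ℝ] EuclideanSpace ℝ (Fin 3) :=
  ((EuclideanSpace.equiv (Fin 3) ℝ).symm : R3 →L[ℝ] EuclideanSpace ℝ (Fin 3)).comp
    (ContinuousLinearMap.pi fun i => ContinuousLinearMap.proj i.succ)

lemma norm_spatial_sq (x : R4) : ‖spatial x‖ ^ 2 = x 1 ^ 2 + x 2 ^ 2 + x 3 ^ 2 := by
  rw [EuclideanSpace.real_norm_sq_eq, Fin.sum_univ_three]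
  rfl

lemma quad_eq (x : R4) : quad x = x 0 ^ 2 - ‖spatial x‖ ^ 2 := by
  rw [norm_spatial_sq, quad]; ring

lemma spatial_timeVec : spatial timeVec = 0 := by
  rw [← norm_eq_zero, ← sq_eq_zero_iff, norm_spatial_sq]
  simp [timeVec]

lemma norm_timeVec : ‖timeVec‖ = 1 := by
  apply le_antisymm
  · rw [pi_norm_le_iff_of_nonneg zero_le_one]
    intro i
    fin_cases i <;> simp [timeVec]
  · simpa [timeVec] using norm_le_pi_norm timeVec 0

lemma norm_le_norm_spatial_add {v : R4} (h : 0 ≤ v 0) : ‖v‖ ≤ ‖spatial v‖ + v 0 := by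
  have hs := norm_spatial_sq v
  have key : ∀ i : Fin 4, i ≠ 0 → |v i| ≤ ‖spatial v‖ := by
    intro i hi
    apply abs_le_of_sq_le_sq _ (norm_nonneg _)
    rw [hs]
    fin_cases i
    · exact absurd rfl hi
    · show v 1 ^ 2 ≤ _
      nlinarith [sq_nonneg (v 1), sq_nonneg (v 2), sq_nonneg (v 3)]
    · show v 2 ^ 2 ≤ _
      nlinarith [sq_nonneg (v 1), sq_nonneg (v 2), sq_nonneg (v 3)]
    · show v 3 ^ 2 ≤ _
      nlinarith [sq_nonneg (v 1), sq_nonneg (v 2), sq_nonneg (v 3)]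
  rw [pi_norm_le_iff_of_nonneg (by positivity)]
  intro i
  by_cases hi : i = 0
  · subst hi
    rw [Real.norm_eq_abs, abs_of_nonneg h]
    linarith [norm_nonneg (spatial v)]
  · rw [Real.norm_eq_abs]
    linarith [key i hi]

/-- The vertical projection to the future light cone. -/
def coneProj (x : R4) : R4 := x + (‖spatial x‖ - x 0) • timeVec

lemma spatial_coneProj (x : R4) : spatial (coneProj x) = spatial x := by
  rw [coneProj, map_add, map_smul, spatial_timeVec, smul_zero, add_zero]

lemma quad_coneProj (x : R4) : quad (coneProj x) = 0 := by
  rw [quad_eq, spatial_coneProj]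
  simp [coneProj, timeVec]

lemma continuous_coneProj : Continuous coneProj := by
  unfold coneProj
  fun_prop

lemma norm_sub_coneProj (x : R4) : ‖x - coneProj x‖ = |‖spatial x‖ - x 0| := by
  rw [coneProj, sub_add_cancel_left, norm_neg, norm_smul, norm_timeVec, mul_one, Real.norm_eq_abs]

lemma coneProj_of_quad_eq_zero {x : R4} (h : quad x = 0) (h0 : 0 ≤ x 0) : coneProj x = x := by
  rw [quad_eq] at h
  have : ‖spatial x‖ = x 0 := by
    rw [← abs_of_nonneg h0, ← abs_of_nonneg (norm_nonneg (spatial x)), ← sq_eq_sq_iff_abs_eq_abs]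
    linarith
  rw [coneProj, this, sub_self, zero_smul, add_zero]

/-- A Gronwall inequality for the distance to the solid future light cone. -/
lemma norm_spatial_le_of_deriv_le {γ v : ℝ → R4} {s₀ s₁ C : ℝ} (hγ : ContinuousOn γ (Icc s₀ s₁))
    (hd : ∀ s ∈ Ico s₀ s₁, HasDerivWithinAt γ (v s) (Ici s) s)
    (hv : ∀ s ∈ Ico s₀ s₁, 0 < ‖spatial (γ s)‖ - γ s 0 →
      ‖spatial (v s)‖ - v s 0 ≤ C * (‖spatial (γ s)‖ - γ s 0))
    (h0 : ‖spatial (γ s₀)‖ ≤ γ s₀ 0) {s : ℝ} (hs : s ∈ Icc s₀ s₁) :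
    ‖spatial (γ s)‖ ≤ γ s 0 := by
  set f : ℝ → ℝ := fun s => ‖spatial (γ s)‖ - γ s 0 with hf
  have hfc : ContinuousOn f (Icc s₀ s₁) :=
    (spatial.continuous.comp_continuousOn hγ).norm.sub
      ((continuous_apply 0).comp_continuousOn hγ)
  -- The norm need not be differentiable where the spatial part vanishes, so only right slopes are
  -- bounded from above.
  have hslope : ∀ x ∈ Ico s₀ s₁, ∀ r, ‖spatial (v x)‖ - v x 0 < r →
      ∃ᶠ z in 𝓝[>] x, slope f x z < r := by
    intro x hx r hr
    have h1 : HasDerivWithinAt (fun s => spatial (γ s)) (spatial (v x)) (Ioi x) x :=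
      (spatial.hasFDerivAt.comp_hasDerivWithinAt x (hd x hx)).mono Ioi_subset_Ici_self
    have h2 : HasDerivWithinAt (fun s => γ s 0) (v x 0) (Ioi x) x :=
      ((hasDerivWithinAt_pi.1 (hd x hx)) 0).mono Ioi_subset_Ici_self
    set e := (r - (‖spatial (v x)‖ - v x 0)) / 2 with he
    have he0 : 0 < e := by rw [he]; linarith
    have h3 := h1.limsup_slope_norm_le (r := ‖spatial (v x)‖ + e) (by linarith)
    have h4 := ((hasDerivWithinAt_iff_tendsto_slope' self_notMem_Ioi).1 h2).eventually
      (lt_mem_nhds (show v x 0 - e < v x 0 by linarith))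
    refine Eventually.frequently ?_
    filter_upwards [h3, h4, self_mem_nhdsWithin] with z h3 h4 hz
    have hz : x < z := hz
    rw [Real.norm_eq_abs, abs_of_pos (by linarith)] at h3
    rw [slope_def_field, div_eq_inv_mul] at h4 ⊢
    have : (z - x)⁻¹ * (f z - f x) = (z - x)⁻¹ * (‖spatial (γ z)‖ - ‖spatial (γ x)‖)
        - (z - x)⁻¹ * (γ z 0 - γ x 0) := by simp only [hf]; ring
    rw [this]
    linarith
  -- Comparison with a positive barrier. The rate `C + 1` instead of `C` gives the strict inequality
  -- needed where `f` meets the barrier, and there `f > 0`, so the hypothesis on `v` applies.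
  have hle : ∀ ε, 0 < ε → f s ≤ ε * Real.exp ((C + 1) * (s - s₀)) := by
    intro ε hε
    have hB (x : ℝ) : HasDerivAt (fun s => ε * Real.exp ((C + 1) * (s - s₀)))
        (ε * (Real.exp ((C + 1) * (x - s₀)) * ((C + 1) * 1))) x :=
      ((((hasDerivAt_id' x).sub_const s₀).const_mul (C + 1)).exp).const_mul ε
    refine image_le_of_liminf_slope_right_lt_deriv_boundary' hfc hslope (B' := fun x =>
      ε * (Real.exp ((C + 1) * (x - s₀)) * ((C + 1) * 1))) ?_
      (fun x _ => (hB x).continuousAt.continuousWithinAt)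
      (fun x _ => (hB x).hasDerivWithinAt) ?_ hs
    · simp only [hf, sub_self, mul_zero, Real.exp_zero, mul_one]
      linarith
    · intro x hx hfx
      have hpos : 0 < f x := by rw [hfx]; positivity
      have := hv x hx hpos
      calc _ ≤ C * f x := this
        _ < (C + 1) * f x := by linarith
        _ = _ := by rw [hfx]; ring
  have hlim : Tendsto (fun ε : ℝ => ε * Real.exp ((C + 1) * (s - s₀))) (𝓝[>] 0) (𝓝 0) := by
    have : Tendsto (fun ε : ℝ => ε * Real.exp ((C + 1) * (s - s₀))) (𝓝 0)
        (𝓝 (0 * Real.exp ((C + 1) * (s - s₀)))) := Continuous.tendsto (by fun_prop) 0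
    rw [zero_mul] at this
    exact this.mono_left nhdsWithin_le_nhds
  have : f s ≤ 0 := ge_of_tendsto hlim (by
    filter_upwards [self_mem_nhdsWithin] with ε hε
    exact hle ε hε)
  simp only [hf] at this
  linarith

section

variable {a : ℝ → ℝ} {τ₀ : ℝ} {S : CoordSpacetime}

/-- The future half of the region. -/
def futureRegion (a : ℝ → ℝ) (τ₀ : ℝ) : Set R4 := region a τ₀ ∩ {x | 0 ≤ x 0}

namespace IsPTExtension

/-- Close to the light cone, the causal vectors are close to those of Minkowski space. -/
lemma norm_spatial_sub_le (ha : IsScaleFactor a) (hτ₀ : 0 < τ₀) (hS : IsPTExtension a τ₀ S)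
    {p v : R4} {L : ℝ}
    (hL : ‖S.metric p - S.metric (coneProj p)‖ ≤ L * (‖spatial p‖ - p 0))
    (hv : S.metric p v v ≤ 0) (hv0 : 0 < v 0) :
    ‖spatial v‖ - v 0 ≤ L / S.conf 0 * (‖spatial p‖ - p 0) * ‖v‖ := by
  have hc := hS.conf_zero_pos ha hτ₀
  set w := ‖spatial p‖ - p 0
  -- At the projected point, which lies on the cone, the metric is known; replacing `p` by it costs
  -- `L * w * ‖v‖²`.
  have h1 : S.metric (coneProj p) v v ≤ L * w * ‖v‖ * ‖v‖ := by
    have h2 : ‖(S.metric p - S.metric (coneProj p)) v v‖ ≤ L * w * ‖v‖ * ‖v‖ :=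
      ContinuousLinearMap.le_of_opNorm₂_le_of_le _ hL le_rfl le_rfl
    have h3 : (S.metric p - S.metric (coneProj p)) v v
      = S.metric p v v - S.metric (coneProj p) v v := rfl
    rw [h3, Real.norm_eq_abs] at h2
    linarith [neg_abs_le (S.metric p v v - S.metric (coneProj p) v v)]
  rw [hS.metric_eq ha hτ₀ (mem_region_of_quad_eq_zero (quad_coneProj p)), quad_coneProj,
    Real.sqrt_zero, mink_self, quad_eq] at h1
  have hL0 : 0 ≤ L * w := le_trans (norm_nonneg (S.metric p - S.metric (coneProj p))) hL
  have hvn : 0 < ‖v‖ := norm_pos_iff.2 (by rintro rfl; simp at hv0)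
  rcases le_or_gt (‖spatial v‖ - v 0) 0 with h | h
  · refine h.trans ?_
    have : L / S.conf 0 * w * ‖v‖ = L * w / S.conf 0 * ‖v‖ := by ring
    rw [this]
    positivity
  -- Here `-quad v` factors as `(‖spatial v‖ - v 0) * (‖spatial v‖ + v 0)`; the second factor is at
  -- least `‖v‖`, so one `‖v‖` cancels from the quadratic bound.
  · have h2 := norm_le_norm_spatial_add hv0.le
    have h3 : (‖spatial v‖ - v 0) * ‖v‖ ≤ (‖spatial v‖ - v 0) * (‖spatial v‖ + v 0) := by gcongr
    have h4 : S.conf 0 * ((‖spatial v‖ - v 0) * ‖v‖) ≤ L * w * ‖v‖ * ‖v‖ := by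
      calc _ ≤ S.conf 0 * ((‖spatial v‖ - v 0) * (‖spatial v‖ + v 0)) := by gcongr
        _ = S.conf 0 * -(v 0 ^ 2 - ‖spatial v‖ ^ 2) := by ring
        _ ≤ _ := h1
    have h5 : S.conf 0 * (‖spatial v‖ - v 0) ≤ L * w * ‖v‖ :=
      le_of_mul_le_mul_right (by linarith) hvn
    have h6 : L / S.conf 0 * w * ‖v‖ = L * w * ‖v‖ / S.conf 0 := by ring
    rw [h6, le_div_iff₀ hc]
    linarith

/-- If the limit is timelike, the approximating points put every smaller radius into `radii`, and
`sqrt_quad_mem_radii` then adds the limiting one. -/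
lemma mem_region_of_mem_closure (ha : IsScaleFactor a) (hτ₀ : 0 < τ₀)
    (hS : IsPTExtension a τ₀ S) {x : R4} (hx : x ∈ S.carrier) (hcl : x ∈ closure (region a τ₀)) :
    x ∈ region a τ₀ := by
  have hq : 0 ≤ quad x :=
    closure_minimal (fun y hy => hy.1) (isClosed_le continuous_const continuous_quad) hcl
  rcases hq.eq_or_lt with h | h
  · exact mem_region_of_quad_eq_zero h.symm
  refine ⟨hq, Or.inr (hS.sqrt_quad_mem_radii ha hτ₀ hx h fun ρ hρ hlt => ?_)⟩
  obtain ⟨y, hy1, hy2⟩ := mem_closure_iff.1 hcl {y | ρ < √(quad y)}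
    (isOpen_lt continuous_const continuous_quad.sqrt) hlt
  have hy1 : ρ < √(quad y) := hy1
  refine radii_of_le ha hτ₀ (hy2.2.resolve_left fun h0 => ?_) hρ hy1.le
  rw [h0, Real.sqrt_zero] at hy1
  linarith

/-- At a timelike point this is openness. At a point of the cone, the origin included, the Gronwall
estimate keeps the curve inside, since outside the metric differs from its value on the cone by at
most a multiple of the vertical distance. -/
lemma eventually_mem_futureRegion (ha : IsScaleFactor a) (hτ₀ : 0 < τ₀)
    (hS : IsPTExtension a τ₀ S) {γ : ℝ → R4} (hγ : ContDiffOn ℝ 1 γ (Icc 0 1))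
    (hc : ∀ s ∈ Icc (0 : ℝ) 1, γ s ∈ S.carrier ∧
      S.IsFutureCausal (γ s) (derivWithin γ (Icc 0 1) s))
    {s₀ : ℝ} (hs₀ : s₀ ∈ Ico (0 : ℝ) 1) (h0 : γ s₀ ∈ futureRegion a τ₀) :
    ∀ᶠ s in 𝓝[>] s₀, γ s ∈ futureRegion a τ₀ := by
  have hs₀' : s₀ ∈ Icc (0 : ℝ) 1 := Ico_subset_Icc_self hs₀
  have hle : 𝓝[≥] s₀ ≤ 𝓝[Icc 0 1] s₀ :=
    nhdsWithin_le_of_mem (mem_of_superset (Icc_mem_nhdsGE hs₀.2) (Icc_subset_Icc_left hs₀.1))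
  have hγt : Tendsto γ (𝓝[≥] s₀) (𝓝 (γ s₀)) := (hγ.continuousOn s₀ hs₀').mono_left hle
  rcases h0.1.1.eq_or_lt with hq | hq
  · set v := derivWithin γ (Icc 0 1) with hv
    have hvt : Tendsto v (𝓝[≥] s₀) (𝓝 (v s₀)) :=
      (hγ.continuousOn_derivWithin (uniqueDiffOn_Icc zero_lt_one) le_rfl s₀ hs₀').mono_left hle
    obtain ⟨L, U, hU, hLip⟩ := (S.contDiffOn_metric.contDiffAt (S.isOpen_carrier.mem_nhds
      (hc s₀ hs₀').1) |>.of_le one_le_two).exists_lipschitzOnWith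
    have e1 : ∀ᶠ s in 𝓝[≥] s₀, γ s ∈ U := hγt.eventually hU
    -- The Lipschitz bound needs the projected points in `U` as well; `coneProj` is continuous and
    -- fixes `γ s₀`.
    have e2 : ∀ᶠ s in 𝓝[≥] s₀, coneProj (γ s) ∈ U := by
      refine ((continuous_coneProj.tendsto _).comp hγt).eventually ?_
      rwa [coneProj_of_quad_eq_zero hq.symm h0.2]
    have e3 : ∀ᶠ s in 𝓝[≥] s₀, 0 < v s 0 := by
      refine (((continuous_apply 0).tendsto _).comp hvt).eventually (lt_mem_nhds ?_)
      exact ((hS.isFutureCausal_iff ha hτ₀ h0.1 _).1 (hc s₀ hs₀').2).2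
    have e4 : ∀ᶠ s in 𝓝[≥] s₀, ‖v s‖ < ‖v s₀‖ + 1 :=
      hvt.norm.eventually (gt_mem_nhds (lt_add_one _))
    have e5 := hγt.eventually (eventually_mem_region ha hτ₀ hq.symm)
    have e6 : ∀ᶠ s in 𝓝[≥] s₀, s < 1 := nhdsWithin_le_nhds (gt_mem_nhds hs₀.2)
    obtain ⟨s₁, hs₁, hsub⟩ := mem_nhdsGE_iff_exists_Icc_subset.1
      (e1.and (e2.and (e3.and (e4.and (e5.and e6)))))
    have hs₁ : s₀ < s₁ := hs₁
    have hsub' : Icc s₀ s₁ ⊆ Icc 0 1 := fun s hs =>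
      ⟨hs₀.1.trans hs.1, (hsub hs).2.2.2.2.2.le⟩
    have hcone : ‖spatial (γ s₀)‖ ≤ γ s₀ 0 := by
      rw [quad_eq] at hq
      exact le_of_sq_le_sq (by linarith) h0.2
    filter_upwards [Ioc_mem_nhdsGT hs₁] with s hs
    have hs' : s ∈ Icc s₀ s₁ := Ioc_subset_Icc_self hs
    have hnorm : ‖spatial (γ s)‖ ≤ γ s 0 := by
      have hcpos := hS.conf_zero_pos ha hτ₀
      refine norm_spatial_le_of_deriv_le (v := v) (C := L / S.conf 0 * (‖v s₀‖ + 1))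
        (hγ.continuousOn.mono hsub') ?_ ?_ hcone hs'
      · intro t ht
        have ht' := hsub' (Ico_subset_Icc_self ht)
        have ht1 := (hsub (Ico_subset_Icc_self ht)).2.2.2.2.2
        exact ((hγ.differentiableOn one_ne_zero t ht').hasDerivWithinAt).mono_of_mem_nhdsWithin
          (mem_of_superset (Icc_mem_nhdsGE ht1) (Icc_subset_Icc_left ht'.1))
      · intro t ht hpos
        obtain ⟨b1, b2, b3, b4, -, -⟩ := hsub (Ico_subset_Icc_self ht)
        have hlip := hLip.norm_sub_le b1 b2
        rw [norm_sub_coneProj, abs_of_pos hpos] at hlip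
        refine (hS.norm_spatial_sub_le ha hτ₀ hlip
          (hc t (hsub' (Ico_subset_Icc_self ht))).2.2.1 b3).trans ?_
        calc _ ≤ L / S.conf 0 * (‖spatial (γ t)‖ - γ t 0) * (‖v s₀‖ + 1) := by gcongr
          _ = _ := by ring
    refine ⟨(hsub hs').2.2.2.2.1 ?_, (norm_nonneg _).trans hnorm⟩
    rw [quad_eq]
    nlinarith [norm_nonneg (spatial (γ s))]
  · have hi := mem_innerRegion_of_pos h0.1 hq
    have h1 : 0 < γ s₀ 0 := lt_of_le_of_ne h0.2 (apply_zero_ne_zero_of_quad_pos hq).symm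
    have e1 := hγt.eventually ((isOpen_innerRegion ha hτ₀).mem_nhds hi)
    have e2 : ∀ᶠ s in 𝓝[≥] s₀, 0 < γ s 0 :=
      (((continuous_apply 0).tendsto _).comp hγt).eventually (lt_mem_nhds h1)
    filter_upwards [(e1.and e2).filter_mono (nhdsWithin_mono _ Ioi_subset_Ici_self)] with s hs
    exact ⟨innerRegion_subset hs.1, hs.2.le⟩

/-- The parameters at which the curve is in the future region form a closed set that is open to the
right and contains `0`, hence all of `[0, 1]`. -/
lemma mem_futureRegion_of_causalStep (ha : IsScaleFactor a) (hτ₀ : 0 < τ₀)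
    (hS : IsPTExtension a τ₀ S) {p q : R4} (h : S.CausalStep p q) (hp : p ∈ futureRegion a τ₀) :
    q ∈ futureRegion a τ₀ := by
  obtain ⟨γ, hγ, rfl, rfl, hc⟩ := h
  have hclosed : IsClosed ({s | γ s ∈ futureRegion a τ₀} ∩ Icc (0 : ℝ) 1) := by
    apply isClosed_of_closure_subset
    intro s hs
    have hsI : s ∈ Icc (0 : ℝ) 1 := closure_minimal inter_subset_right isClosed_Icc hs
    have hcont := (hγ.continuousOn s hsI).mono
      (inter_subset_right (s := {s | γ s ∈ futureRegion a τ₀}))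
    refine ⟨⟨hS.mem_region_of_mem_closure ha hτ₀ (hc s hsI).1
      (hcont.mem_closure hs fun t ht => ht.1.1), ?_⟩, hsI⟩
    have h1 : IsClosed {x : R4 | 0 ≤ x 0} := isClosed_le continuous_const (continuous_apply 0)
    exact closure_minimal (fun _ h => h) h1
      (hcont.mem_closure hs (t := {x : R4 | 0 ≤ x 0}) fun t ht => ht.1.2)
  exact hclosed.Icc_subset_of_forall_mem_nhdsWithin hp
    (fun s hs => hS.eventually_mem_futureRegion ha hτ₀ hγ hc hs.2 hs.1)
    (right_mem_Icc.2 zero_le_one)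

lemma causalFuture_subset (ha : IsScaleFactor a) (hτ₀ : 0 < τ₀) (hS : IsPTExtension a τ₀ S) :
    S.causalFuture 0 ⊆ futureRegion a τ₀ := by
  intro q hq
  change Relation.ReflTransGen S.CausalStep 0 q at hq
  induction hq with
  | refl => exact ⟨zero_mem_region, by simp⟩
  | tail _ h ih => exact hS.mem_futureRegion_of_causalStep ha hτ₀ h ih

/-- Segments in the region whose direction is causal for the Minkowski metric are
causal curves. -/
lemma causalStep_of_segment (ha : IsScaleFactor a) (hτ₀ : 0 < τ₀) (hS : IsPTExtension a τ₀ S)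
    {p v : R4} (hseg : ∀ s ∈ Icc (0 : ℝ) 1, p + s • v ∈ region a τ₀) (hv : 0 ≤ quad v)
    (hv0 : 0 < v 0) : S.CausalStep p (p + v) := by
  have hd (s : ℝ) : HasDerivAt (fun s : ℝ => p + s • v) v s := by
    simpa using ((hasDerivAt_id' s).smul_const v).const_add p
  refine ⟨fun s => p + s • v, ContDiff.contDiffOn (by fun_prop), by simp, by simp, fun s hs => ?_⟩
  rw [(hd s).hasDerivWithinAt.derivWithin (uniqueDiffOn_Icc zero_lt_one s hs)]
  exact ⟨hS.region_subset_carrier (hseg s hs),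
    (hS.isFutureCausal_iff ha hτ₀ (hseg s hs) v).2 ⟨hv, hv0⟩⟩

lemma futureRegion_subset (ha : IsScaleFactor a) (hτ₀ : 0 < τ₀) (hS : IsPTExtension a τ₀ S) :
    futureRegion a τ₀ ⊆ S.causalFuture 0 := by
  intro q hq
  by_cases h0 : q = 0
  · rw [h0]; exact Relation.ReflTransGen.refl
  have := hS.causalStep_of_segment ha hτ₀ (p := 0) (v := q)
    (fun s hs => by rw [zero_add]; exact smul_mem_region ha hτ₀ hq.1 hs.1 hs.2) hq.1.1
    (lt_of_le_of_ne hq.2 (apply_zero_ne_zero hq.1.1 h0).symm)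
  rw [zero_add] at this
  exact Relation.ReflTransGen.single this

end IsPTExtension

/-! ### The causal past, through the reflected time orientation. -/

/-- The spacetime with the time orientation which is reflected at the origin. -/
def CoordSpacetime.reflect (S : CoordSpacetime) (hneg : ∀ x ∈ S.carrier, -x ∈ S.carrier)
    (hiso : ∀ x ∈ S.carrier, ∀ u v : R4, S.metric (-x) (-u) (-v) = S.metric x u v) :
    CoordSpacetime where
  carrier := S.carrier
  isOpen_carrier := S.isOpen_carrier
  metric := S.metric
  contDiffOn_metric := S.contDiffOn_metric
  metric_symm := S.metric_symm
  lorentzian := S.lorentzian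
  timeField := fun x => S.timeField (-x)
  continuousOn_timeField :=
    S.continuousOn_timeField.comp continuous_neg.continuousOn hneg
  timeField_timelike := by
    intro p hp
    rw [← hiso p hp]
    simpa using S.timeField_timelike (-p) (hneg p hp)

namespace IsPTExtension

lemma metric_neg (hS : IsPTExtension a τ₀ S) {x : R4} (hx : x ∈ S.carrier) (u v : R4) :
    S.metric (-x) u v = S.metric x u v := by
  rw [← hS.neg_isometry x hx u v]
  simp

/-- This lets the result on causal futures apply to the causal past. On the region the time field
has positive time component at `-x` as well as at `x`, so `∂/∂τ` remains future directed. -/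
lemma reflect (ha : IsScaleFactor a) (hτ₀ : 0 < τ₀) (hS : IsPTExtension a τ₀ S) :
    IsPTExtension a τ₀ (S.reflect hS.neg_mem hS.neg_isometry) where
  coords_mem := hS.coords_mem
  isometric := hS.isometric
  future := by
    intro τ w hτ
    set x := coords a τ₀ (τ, w) with hx
    -- As `b' = b/a`, the field `∂/∂τ` is the position vector divided by `a`.
    have hq1 : coordsDeriv a τ₀ τ w (1, 0) = (1 / a τ) • x := by
      funext i
      refine Fin.cases ?_ (fun i => ?_) i
      · simp [coordsDeriv, hx, coords_zero]; ring
      · simp [coordsDeriv, hx, coords_succ]; ring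
    have hb := radius_pos a τ₀ τ
    have hw := one_add_dotProduct_self_pos w
    have hx0 : 0 < x 0 := by
      rw [hx, coords_zero]
      exact mul_pos hb (Real.sqrt_pos.2 hw)
    have hquad : quad x = radius a τ₀ τ ^ 2 := by
      rw [quad, show (1 : Fin 4) = Fin.succ 0 from rfl, show (2 : Fin 4) = Fin.succ 1 from rfl,
        show (3 : Fin 4) = Fin.succ 2 from rfl, hx]
      simp only [coords_zero, coords_succ]
      rw [mul_pow, Real.sq_sqrt hw.le]
      simp only [dotProduct, Fin.sum_univ_three]
      ring
    have hxq : 0 < quad x := by rw [hquad]; positivity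
    have hxr : x ∈ region a τ₀ :=
      ⟨hxq.le, Or.inr ⟨τ, hτ, by rw [hquad, Real.sqrt_sq hb.le]⟩⟩
    have hnr := neg_mem_region hxr
    have hT : 0 < quad (S.timeField (-x)) := by
      have h := S.timeField_timelike (-x) (hS.region_subset_carrier hnr)
      rw [hS.metric_eq ha hτ₀ hnr, mink_self] at h
      have := hS.conf_pos ha hτ₀ hnr
      nlinarith
    rw [fderiv_coords ha hτ₀ hτ, hq1]
    change S.metric x (S.timeField (-x)) ((1 / a τ) • x) < 0
    rw [hS.metric_eq ha hτ₀ hxr, mink_smul_right]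
    have := ha.pos τ hτ
    exact mul_neg_of_pos_of_neg (hS.conf_pos ha hτ₀ hxr) (mul_neg_of_pos_of_neg (by positivity)
      (mink_neg hT (hS.timeField_apply_zero_pos ha hτ₀ hnr) hxq.le hx0))
  cone_mem := hS.cone_mem
  neg_mem := hS.neg_mem
  neg_isometry := hS.neg_isometry

/-- Reflecting and reversing a curve changes the sign of its velocity twice, so `s ↦ -γ (1 - s)` has
the velocity of `γ` at `1 - s`, and the reflected time field at its point is the original one at `γ
(1 - s)`. -/
lemma reflect_causalStep (hS : IsPTExtension a τ₀ S) {p q : R4} (h : S.CausalStep p q) :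
    (S.reflect hS.neg_mem hS.neg_isometry).CausalStep (-q) (-p) := by
  obtain ⟨γ, hγ, rfl, rfl, hc⟩ := h
  have hmaps : MapsTo (fun s : ℝ => 1 - s) (Icc 0 1) (Icc 0 1) := fun s hs =>
    ⟨by linarith [hs.2], by linarith [hs.1]⟩
  refine ⟨fun s => -γ (1 - s), ?_, by simp, by simp, fun s hs => ?_⟩
  · exact (hγ.comp (ContDiff.contDiffOn (by fun_prop)) hmaps).neg
  · have hs' := hmaps hs
    have h1 := (hγ.differentiableOn one_ne_zero (1 - s) hs').hasDerivWithinAt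
    have h2 : HasDerivWithinAt (fun s : ℝ => 1 - s) (-1) (Icc 0 1) s := by
      simpa using ((hasDerivAt_id' s).const_sub 1).hasDerivWithinAt
    have h3 : HasDerivWithinAt (fun s => -γ (1 - s)) (derivWithin γ (Icc 0 1) (1 - s))
        (Icc 0 1) s := by
      refine (HasDerivWithinAt.scomp s h1 h2 hmaps).neg.congr_deriv ?_
      simp
    rw [h3.derivWithin (uniqueDiffOn_Icc zero_lt_one s hs)]
    obtain ⟨hm, hne, h4, h5⟩ := hc (1 - s) hs'
    refine ⟨hS.neg_mem _ hm, hne, ?_, ?_⟩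
    · change S.metric (-γ (1 - s)) _ _ ≤ 0
      rwa [hS.metric_neg hm]
    · change S.metric (-γ (1 - s)) (S.timeField (-(-γ (1 - s)))) _ < 0
      rwa [hS.metric_neg hm, neg_neg]

lemma causalPast_subset (ha : IsScaleFactor a) (hτ₀ : 0 < τ₀) (hS : IsPTExtension a τ₀ S) :
    S.causalPast 0 ⊆ region a τ₀ := by
  intro q hq
  have hq : Relation.ReflTransGen S.CausalStep q 0 := hq
  have h : -q ∈ (S.reflect hS.neg_mem hS.neg_isometry).causalFuture 0 := by
    have h1 := hq.swap.lift (p := (S.reflect hS.neg_mem hS.neg_isometry).CausalStep)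
      (fun x => -x) (fun x y h => hS.reflect_causalStep h)
    change Relation.ReflTransGen _ (-0) (-q) at h1
    rwa [neg_zero] at h1
  have := ((hS.reflect ha hτ₀).causalFuture_subset ha hτ₀ h).1
  simpa using neg_mem_region this

/-- The union of the causal future and of the causal past of the origin. -/
lemma causalSet_eq (ha : IsScaleFactor a) (hτ₀ : 0 < τ₀) (hS : IsPTExtension a τ₀ S) :
    S.causalSet 0 = region a τ₀ := by
  apply Subset.antisymm
  · exact union_subset ((hS.causalFuture_subset ha hτ₀).trans inter_subset_left)
      (hS.causalPast_subset ha hτ₀)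
  · intro q hq
    rcases le_or_gt 0 (q 0) with h | h
    · exact Or.inl (hS.futureRegion_subset ha hτ₀ ⟨hq, h⟩)
    · have := hS.causalStep_of_segment ha hτ₀ (p := q) (v := -q)
        (fun s hs => by
          have : q + s • -q = (1 - s) • q := by rw [sub_smul, one_smul, smul_neg, sub_eq_add_neg]
          rw [this]
          exact smul_mem_region ha hτ₀ hq (by linarith [hs.2]) (by linarith [hs.1]))
        (by rw [quad_neg]; exact hq.1) (by simpa using h)
      rw [add_neg_cancel] at this
      exact Or.inr (Relation.ReflTransGen.single this)

end IsPTExtension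

end

/-! ## Differential calculus on the region -/

lemma quad_add_smul (x v : R4) (s : ℝ) :
    quad (x + s • v) = quad x - 2 * s * mink x v + s ^ 2 * quad v := by
  simp only [quad, mink, Pi.add_apply, Pi.smul_apply, smul_eq_mul]; ring

lemma fderiv_quad (x v : R4) : fderiv ℝ quad x v = -2 * mink x v := by
  have h1 : HasDerivAt (fun s : ℝ => x + s • v) v 0 := by
    simpa using ((hasDerivAt_id' (0 : ℝ)).smul_const v).const_add x
  have h2 : HasFDerivAt quad (fderiv ℝ quad x) (x + (0 : ℝ) • v) := by
    simpa using ((contDiff_quad (n := 1)).differentiable one_ne_zero x).hasFDerivAt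
  refine (h2.comp_hasDerivAt 0 h1).unique ?_
  have h3 : quad ∘ (fun s : ℝ => x + s • v)
      = fun s : ℝ => quad x - 2 * s * mink x v + s ^ 2 * quad v := by
    ext s; exact quad_add_smul x v s
  rw [h3]
  refine (((((hasDerivAt_id' (0 : ℝ)).const_mul 2).mul_const (mink x v)).const_sub
    (quad x)).fun_add (((hasDerivAt_id' (0 : ℝ)).fun_pow 2).mul_const (quad v))).congr_deriv ?_
  simp

lemma hasFDerivAt_quad (x : R4) : HasFDerivAt quad (fderiv ℝ quad x) x :=
  ((contDiff_quad (n := 1)).differentiable one_ne_zero x).hasFDerivAt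

section region

variable {a : ℝ → ℝ} {τ₀ : ℝ}

lemma region_mem_nhds (ha : IsScaleFactor a) (hτ₀ : 0 < τ₀) {x : R4}
    (hx : x ∈ innerRegion a τ₀) : region a τ₀ ∈ 𝓝 x :=
  mem_of_superset ((isOpen_innerRegion ha hτ₀).mem_nhds hx) innerRegion_subset

lemma ne_zero_of_mem_innerRegion {x : R4} (hx : x ∈ innerRegion a τ₀) : x ≠ 0 := by
  rintro rfl
  exact lt_irrefl _ (quad_zero ▸ hx.1)

/-- Differentials within the region are well defined: near a point of the cone, the origin included,
the region contains a convex solid cone with nonempty interior. -/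
lemma uniqueDiffWithinAt_region (ha : IsScaleFactor a) (hτ₀ : 0 < τ₀) {x : R4}
    (hx : x ∈ region a τ₀) : UniqueDiffWithinAt ℝ (region a τ₀) x := by
  rcases hx.1.eq_or_lt with h | h
  · have key (c : ℝ) (hc : c ^ 2 = 1) (hcx : 0 ≤ c * x 0) :
        UniqueDiffWithinAt ℝ (region a τ₀) x := by
      set C : Set R4 := {y | ‖spatial y‖ ≤ c * y 0} with hC
      have hconv : Convex ℝ C := by
        intro y hy z hz s t hs ht _
        have hy : ‖spatial y‖ ≤ c * y 0 := hy
        have hz : ‖spatial z‖ ≤ c * z 0 := hz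
        change ‖spatial (s • y + t • z)‖ ≤ c * (s • y + t • z) 0
        rw [map_add, map_smul, map_smul]
        calc _ ≤ ‖s • spatial y‖ + ‖t • spatial z‖ := norm_add_le _ _
          _ = s * ‖spatial y‖ + t * ‖spatial z‖ := by
            rw [norm_smul, norm_smul, Real.norm_of_nonneg hs, Real.norm_of_nonneg ht]
          _ ≤ s * (c * y 0) + t * (c * z 0) := by gcongr
          _ = _ := by simp only [Pi.add_apply, Pi.smul_apply, smul_eq_mul]; ring
      have hint : (interior C).Nonempty := by
        refine ⟨c • timeVec, mem_interior.2 ⟨{y | ‖spatial y‖ < c * y 0}, fun y hy => ?_, ?_, ?_⟩⟩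
        · exact le_of_lt (show ‖spatial y‖ < c * y 0 from hy)
        · exact isOpen_lt (by fun_prop) (by fun_prop)
        · change ‖spatial (c • timeVec)‖ < c * (c • timeVec) 0
          rw [map_smul, spatial_timeVec, smul_zero, norm_zero]
          simp only [timeVec, Pi.smul_apply, cons_val_zero, smul_eq_mul]
          nlinarith
      have hxC : x ∈ C := by
        refine abs_le_of_sq_le_sq' ?_ hcx |>.2
        rw [quad_eq] at h
        rw [mul_pow, hc]
        linarith
      refine ((uniqueDiffOn_convex hconv hint x hxC).inter
        (eventually_mem_region ha hτ₀ h.symm)).mono ?_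
      rintro y ⟨hy1, hy2⟩
      refine hy2 ?_
      have hy1 : ‖spatial y‖ ≤ c * y 0 := hy1
      have := pow_le_pow_left₀ (norm_nonneg _) hy1 2
      rw [mul_pow, hc] at this
      rw [quad_eq]
      linarith
    rcases le_total 0 (x 0) with h0 | h0
    · exact key 1 (by norm_num) (by linarith)
    · exact key (-1) (by norm_num) (by linarith)
  · exact uniqueDiffWithinAt_of_mem_nhds (region_mem_nhds ha hτ₀ (mem_innerRegion_of_pos hx h))

/-- The function `quad` defines the boundary: its derivative along `∂/∂t` is `2 * x 0`, which
vanishes on the cone only at the origin. -/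
lemma isManifoldWithBoundary_region (ha : IsScaleFactor a) (hτ₀ : 0 < τ₀) :
    IsManifoldWithBoundary (region a τ₀ \ {0}) := by
  rintro x ⟨hx, hx0⟩
  have hx0 : x ≠ 0 := hx0
  rcases hx.1.eq_or_lt with h | h
  · right
    obtain ⟨V, hVsub, hVo, hxV⟩ := mem_nhds_iff.1 (eventually_mem_region ha hτ₀ h.symm)
    refine ⟨V ∩ {0}ᶜ, hVo.inter isOpen_compl_singleton, ⟨hxV, hx0⟩, quad,
      contDiff_quad.contDiffOn, h.symm, fun h0 => ?_, ?_⟩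
    · have h1 := fderiv_quad x timeVec
      rw [h0, mink_timeVec_right] at h1
      simp at h1
      exact apply_zero_ne_zero hx.1 hx0 h1
    · ext y
      constructor
      · rintro ⟨⟨h1, -⟩, h2⟩
        exact ⟨h2, h1.1⟩
      · rintro ⟨⟨h1, h2⟩, h3⟩
        exact ⟨⟨hVsub h1 h3, h2⟩, h1, h2⟩
  · left
    exact mem_of_superset ((isOpen_innerRegion ha hτ₀).mem_nhds (mem_innerRegion_of_pos hx h))
      fun y hy => ⟨innerRegion_subset hy, ne_zero_of_mem_innerRegion hy⟩

end region

/-! ## Isometries of the region -/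

/-- `F` and `G` are mutually inverse diffeomorphisms of `A \ {0}` which fix the origin and
which are isometric on `A \ {0}`. -/
structure IsIsometryPair (S : CoordSpacetime) (A : Set R4) (F G : R4 → R4) : Prop where
  mapsTo : MapsTo F A A
  mapsTo_inv : MapsTo G A A
  left_inv : ∀ x ∈ A, G (F x) = x
  right_inv : ∀ x ∈ A, F (G x) = x
  map_zero : F 0 = 0
  contDiffOn : ContDiffOn ℝ 1 F (A \ {0})
  contDiffOn_inv : ContDiffOn ℝ 1 G (A \ {0})
  isometry : ∀ x ∈ A, x ≠ 0 → ∀ X Y, S.metric x X Y =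
    S.metric (F x) (fderivWithin ℝ F A x X) (fderivWithin ℝ F A x Y)

namespace IsIsometryPair

variable {a : ℝ → ℝ} {τ₀ : ℝ} {S : CoordSpacetime} {F G : R4 → R4}

lemma differentiableWithinAt {A : Set R4} {F : R4 → R4} (h : ContDiffOn ℝ 1 F (A \ {0})) {x : R4}
    (hx : x ∈ A) (hx0 : x ≠ 0) : DifferentiableWithinAt ℝ F A x := by
  have h1 := h.differentiableOn one_ne_zero x ⟨hx, hx0⟩
  exact h1.mono_of_mem_nhdsWithin (inter_mem self_mem_nhdsWithin
    (mem_nhdsWithin_of_mem_nhds (isOpen_compl_singleton.mem_nhds hx0)))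

lemma symm (ha : IsScaleFactor a) (hτ₀ : 0 < τ₀) (h : IsIsometryPair S (region a τ₀) F G) :
    IsIsometryPair S (region a τ₀) G F where
  mapsTo := h.mapsTo_inv
  mapsTo_inv := h.mapsTo
  left_inv := h.right_inv
  right_inv := h.left_inv
  map_zero := by
    conv_lhs => rw [← h.map_zero]
    exact h.left_inv 0 zero_mem_region
  contDiffOn := h.contDiffOn_inv
  contDiffOn_inv := h.contDiffOn
  isometry := by
    intro x hx hx0 X Y
    have hy : G x ∈ region a τ₀ := h.mapsTo_inv hx
    have hy0 : G x ≠ 0 := by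
      intro h0
      apply hx0
      rw [← h.right_inv x hx, h0, h.map_zero]
    have hG := (differentiableWithinAt h.contDiffOn_inv hx hx0).hasFDerivWithinAt
    have hF := (differentiableWithinAt h.contDiffOn hy hy0).hasFDerivWithinAt
    have hid := (uniqueDiffWithinAt_region ha hτ₀ hx).eq (hF.comp x hG h.mapsTo_inv)
      ((hasFDerivWithinAt_id x _).congr (fun y hy => h.right_inv y hy) (h.right_inv x hx))
    have hid' (Z : R4) : fderivWithin ℝ F (region a τ₀) (G x)
        (fderivWithin ℝ G (region a τ₀) x Z) = Z := by
      simpa using congrArg (fun T : R4 →L[ℝ] R4 => T Z) hid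
    rw [h.isometry (G x) hy hy0, hid', hid', h.right_inv x hx]

variable (ha : IsScaleFactor a) (hτ₀ : 0 < τ₀) (hS : IsPTExtension a τ₀ S)
  (h : IsIsometryPair S (region a τ₀) F G)

include ha hτ₀ h

lemma contDiffAt {x : R4} (hx : x ∈ innerRegion a τ₀) : ContDiffAt ℝ 1 F x :=
  h.contDiffOn.contDiffAt (inter_mem (region_mem_nhds ha hτ₀ hx)
    (isOpen_compl_singleton.mem_nhds (ne_zero_of_mem_innerRegion hx)))

lemma hasFDerivAt {x : R4} (hx : x ∈ innerRegion a τ₀) : HasFDerivAt F (fderiv ℝ F x) x :=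
  ((h.contDiffAt ha hτ₀ hx).differentiableAt one_ne_zero).hasFDerivAt

lemma metric_fderiv {x : R4} (hx : x ∈ innerRegion a τ₀) (X Y : R4) :
    S.metric x X Y = S.metric (F x) (fderiv ℝ F x X) (fderiv ℝ F x Y) := by
  rw [← fderivWithin_of_mem_nhds (region_mem_nhds ha hτ₀ hx)]
  exact h.isometry x (innerRegion_subset hx) (ne_zero_of_mem_innerRegion hx) X Y

include hS

lemma fderiv_surjective {x : R4} (hx : x ∈ innerRegion a τ₀) :
    Function.Surjective (fderiv ℝ F x) := by
  have hinj : Function.Injective (fderiv ℝ F x : R4 →ₗ[ℝ] R4) := by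
    rw [← LinearMap.ker_eq_bot, LinearMap.ker_eq_bot']
    intro X hX
    have hX : fderiv ℝ F x X = 0 := hX
    refine eq_zero_of_mink_eq_zero fun Y => ?_
    have h1 := h.metric_fderiv ha hτ₀ hx X Y
    have hr := innerRegion_subset hx
    rw [hX, hS.metric_eq ha hτ₀ hr, _root_.map_zero, _root_.zero_apply] at h1
    exact (mul_eq_zero.1 h1).resolve_left (hS.conf_pos ha hτ₀ hr).ne'
  exact LinearMap.injective_iff_surjective.1 hinj

/-- By the inverse function theorem the image of an interior point is interior to the region, hence
not a nonzero point of the cone; the origin is excluded by injectivity. -/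
lemma mapsTo_innerRegion : MapsTo F (innerRegion a τ₀) (innerRegion a τ₀) := by
  intro x hx
  have hr := innerRegion_subset hx
  have hmap := ((h.contDiffAt ha hτ₀ hx).hasStrictFDerivAt one_ne_zero).map_nhds_eq_of_surj
    (LinearMap.range_eq_top.2 (h.fderiv_surjective ha hτ₀ hS hx))
  have hmem : region a τ₀ ∈ 𝓝 (F x) := by
    rw [← hmap]
    exact mem_map.2 (mem_of_superset (region_mem_nhds ha hτ₀ hx) h.mapsTo)
  refine mem_innerRegion_of_pos (h.mapsTo hr) (quad_pos_of_region_mem_nhds hmem fun h0 => ?_)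
  apply ne_zero_of_mem_innerRegion hx
  rw [← h.left_inv x hr, h0, (h.symm ha hτ₀).map_zero]

/-- The image of the curve of an observer at rest is a curve whose cosmic time has derivative
at least `1` in absolute value. -/
lemma exists_hasDerivAt_cosmicTime {n : R4} (hn : quad n = 1) {s : ℝ} (hs : 0 < s) :
    ∃ d, HasDerivAt (fun s => cosmicTime a τ₀ √(quad (F (radius a τ₀ s • n)))) d s ∧
      1 ≤ d ^ 2 := by
  set c := radius a τ₀ s • n with hc
  have hb := radius_pos a τ₀ s
  have hap := ha.pos s hs
  have hquad : quad c = radius a τ₀ s ^ 2 := by rw [hc, quad_smul, hn, mul_one]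
  have hsqrt : √(quad c) = radius a τ₀ s := by rw [hquad, Real.sqrt_sq hb.le]
  have hci : c ∈ innerRegion a τ₀ :=
    ⟨by rw [hquad]; positivity, by rw [hsqrt]; exact ⟨s, hs, rfl⟩⟩
  have hyi := h.mapsTo_innerRegion ha hτ₀ hS hci
  set y := F c with hy
  set ρ := √(quad y) with hρ
  have hρ0 : 0 < ρ := Real.sqrt_pos.2 hyi.1
  have hρ2 : ρ ^ 2 = quad y := Real.sq_sqrt hyi.1.le
  set V := fderiv ℝ F c ((radius a τ₀ s / a s) • n) with hV
  have hd1 : HasDerivAt (fun s => F (radius a τ₀ s • n)) V s :=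
    (h.hasFDerivAt ha hτ₀ hci).comp_hasDerivAt s ((hasDerivAt_radius ha hτ₀ hs).smul_const n)
  have hd2 : HasDerivAt (fun s => quad (F (radius a τ₀ s • n))) (-2 * mink y V) s := by
    have := (hasFDerivAt_quad y).comp_hasDerivAt s hd1
    rwa [fderiv_quad] at this
  have hd3 := (hasDerivAt_cosmicTime ha hτ₀ hyi.2).comp s (hd2.sqrt hyi.1.ne')
  refine ⟨_, hd3, ?_⟩
  rw [← hc, ← hy, ← hρ]
  -- The observer's curve is parametrized by proper time and `F` is isometric, so `V` is a unit
  -- timelike vector for the metric at `y`.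
  have hVq : (a (cosmicTime a τ₀ ρ) / ρ) ^ 2 * quad V = 1 := by
    have h1 := h.metric_fderiv ha hτ₀ hci ((radius a τ₀ s / a s) • n)
      ((radius a τ₀ s / a s) • n)
    rw [hS.metric_eq_of_mem_innerRegion ha hτ₀ hci, hS.metric_eq_of_mem_innerRegion ha hτ₀ hyi,
      hsqrt, cosmicTime_radius ha hτ₀ hs, mink_self, mink_self, quad_smul, hn, ← hρ] at h1
    have h2 : (a s / radius a τ₀ s) ^ 2 * -((radius a τ₀ s / a s) ^ 2 * 1) = -1 := by
      field_simp
    rw [h2] at h1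
    linarith
  have hcs := quad_mul_quad_le hyi.1 V
  have e : (a (cosmicTime a τ₀ ρ) / ρ * (-2 * mink y V / (2 * ρ))) ^ 2
      = (a (cosmicTime a τ₀ ρ) / ρ) ^ 2 * (mink y V ^ 2 / ρ ^ 2) := by
    field_simp
  rw [e, ← hVq]
  gcongr
  rw [le_div_iff₀ (by positivity), hρ2, mul_comm]
  exact hcs

/-- Along the image of the observer through `x`, cosmic time `σ` is positive with `|σ'| ≥ 1`. It
cannot decrease forever, so `σ' ≥ 1`, and integrating from near `0` gives `σ t ≥ t`. -/
lemma cosmicTime_le {x : R4} (hx : x ∈ innerRegion a τ₀) :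
    cosmicTime a τ₀ √(quad x) ≤ cosmicTime a τ₀ √(quad (F x)) := by
  set r := √(quad x) with hr
  have hr0 : 0 < r := Real.sqrt_pos.2 hx.1
  have hr2 : r ^ 2 = quad x := Real.sq_sqrt hx.1.le
  set n := r⁻¹ • x with hn
  have hnq : quad n = 1 := by
    rw [hn, quad_smul, ← hr2]; field_simp
  set σ : ℝ → ℝ := fun s => cosmicTime a τ₀ √(quad (F (radius a τ₀ s • n))) with hσ
  have hpos : ∀ s, 0 < s → 0 < σ s := by
    intro s hs
    have hb := radius_pos a τ₀ s
    have hquad : quad (radius a τ₀ s • n) = radius a τ₀ s ^ 2 := by rw [quad_smul, hnq, mul_one]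
    exact cosmicTime_pos (h.mapsTo_innerRegion ha hτ₀ hS
      ⟨by rw [hquad]; positivity, by rw [hquad, Real.sqrt_sq hb.le]; exact ⟨s, hs, rfl⟩⟩).2
  choose! d hd hd2 using fun s (hs : s ∈ Ioi (0 : ℝ)) =>
    h.exists_hasDerivAt_cosmicTime ha hτ₀ hS hnq (s := s) hs
  have hcont : ContinuousOn σ (Ioi 0) := fun s hs => (hd s hs).continuousAt.continuousWithinAt
  have hdiff : DifferentiableOn ℝ σ (interior (Ioi 0)) := by
    rw [interior_Ioi]
    exact fun s hs => (hd s hs).differentiableAt.differentiableWithinAt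
  have hincr : ∀ s ∈ Ioi (0 : ℝ), 1 ≤ d s := by
    -- Darboux's theorem: a derivative without zeros has constant sign.
    rcases hasDerivWithinAt_forall_lt_or_forall_gt_of_forall_ne (convex_Ioi (0 : ℝ))
      (fun s hs => (hd s hs).hasDerivWithinAt) (m := 0)
      (fun s hs h0 => by have := hd2 s hs; rw [h0] at this; norm_num at this) with hneg | hpos'
    · exfalso
      have h1 : ∀ s ∈ Ioi (0 : ℝ), d s ≤ -1 := fun s hs => by nlinarith [hneg s hs, hd2 s hs]
      have h2 := (convex_Ioi (0 : ℝ)).image_sub_le_mul_sub_of_deriv_le hcont hdiff (C := -1)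
        (by
          rw [interior_Ioi]
          intro s hs
          rw [(hd s hs).deriv]
          exact h1 s hs)
      have h3 := hpos 1 one_pos
      -- With slope at most `-1`, `σ` would be nonpositive after the further time `σ 1`.
      have h4 := h2 1 (mem_Ioi.2 one_pos) (1 + σ 1) (mem_Ioi.2 (by linarith)) (by linarith)
      have h5 := hpos (1 + σ 1) (by linarith)
      linarith
    · exact fun s hs => by nlinarith [hpos' s hs, hd2 s hs]
  have hgrow := (convex_Ioi (0 : ℝ)).mul_sub_le_image_sub_of_le_deriv hcont hdiff (C := 1)
    (by
      rw [interior_Ioi]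
      intro s hs
      rw [(hd s hs).deriv]
      exact hincr s hs)
  set t := cosmicTime a τ₀ r with ht
  have ht0 : 0 < t := cosmicTime_pos hx.2
  have hσt : σ t = cosmicTime a τ₀ √(quad (F x)) := by
    simp only [hσ]
    rw [ht, radius_cosmicTime hx.2, hn, smul_smul, mul_inv_cancel₀ hr0.ne', one_smul]
  rw [← hσt]
  refine le_of_forall_pos_le_add fun ε hε => ?_
  rcases le_or_gt t ε with hle | hlt
  · linarith [hpos t ht0]
  · have := hgrow ε hε t ht0 hlt.le
    linarith [hpos ε hε]

/-- Isometries preserve the Minkowski distance from the origin. -/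
lemma quad_map {x : R4} (hx : x ∈ innerRegion a τ₀) : quad (F x) = quad x := by
  have hy := h.mapsTo_innerRegion ha hτ₀ hS hx
  have h1 := h.cosmicTime_le ha hτ₀ hS hx
  have h2 := (h.symm ha hτ₀).cosmicTime_le ha hτ₀ hS hy
  rw [h.left_inv x (innerRegion_subset hx)] at h2
  have h3 := congrArg (radius a τ₀) (le_antisymm h2 h1)
  rw [radius_cosmicTime hy.2, radius_cosmicTime hx.2] at h3
  rwa [Real.sqrt_inj hy.1.le hx.1.le] at h3

lemma mink_fderiv {x : R4} (hx : x ∈ innerRegion a τ₀) (X Y : R4) :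
    mink (fderiv ℝ F x X) (fderiv ℝ F x Y) = mink X Y := by
  have h1 := h.metric_fderiv ha hτ₀ hx X Y
  have hr := innerRegion_subset hx
  rw [hS.metric_eq ha hτ₀ hr, hS.metric_eq ha hτ₀ (h.mapsTo hr), h.quad_map ha hτ₀ hS hx] at h1
  exact (mul_left_cancel₀ (hS.conf_pos ha hτ₀ hr).ne' h1).symm

/-- Euler's relation. -/
lemma fderiv_apply_self {x : R4} (hx : x ∈ innerRegion a τ₀) : fderiv ℝ F x x = F x := by
  -- The differential of `quad ∘ F = quad`. By `mink_fderiv` the vector `dF_x x` has the same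
  -- products with all `dF_x X`, and these fill the space.
  have h1 (X : R4) : mink (F x) (fderiv ℝ F x X) = mink x X := by
    have h2 : HasFDerivAt (fun y => quad (F y)) ((fderiv ℝ quad (F x)).comp (fderiv ℝ F x)) x :=
      (hasFDerivAt_quad (F x)).comp x (h.hasFDerivAt ha hτ₀ hx)
    have h3 : HasFDerivAt (fun y => quad (F y)) (fderiv ℝ quad x) x := by
      refine (hasFDerivAt_quad x).congr_of_eventuallyEq ?_
      filter_upwards [(isOpen_innerRegion ha hτ₀).mem_nhds hx] with y hy
      exact h.quad_map ha hτ₀ hS hy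
    have h4 := congrArg (fun T : R4 →L[ℝ] ℝ => T X) (h2.unique h3)
    simp only [ContinuousLinearMap.comp_apply, fderiv_quad] at h4
    linarith
  rw [← sub_eq_zero]
  refine eq_zero_of_mink_eq_zero fun Y => ?_
  obtain ⟨X, rfl⟩ := h.fderiv_surjective ha hτ₀ hS hx Y
  rw [mink_sub_left, h.mink_fderiv ha hτ₀ hS hx, h1, sub_self]

/-- Euler's relation makes `s⁻¹ • F (s • x)` constant on `[ε, 1]`. -/
lemma map_smul_of_mem_Ioc {x : R4} (hx : x ∈ innerRegion a τ₀) {ε : ℝ} (hε : ε ∈ Ioc (0 : ℝ) 1) :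
    F (ε • x) = ε • F x := by
  have hd : ∀ s ∈ Icc ε 1, HasDerivAt (fun s : ℝ => s⁻¹ • F (s • x)) 0 s := by
    intro s hs
    have hs0 : 0 < s := hε.1.trans_le hs.1
    have hsx := smul_mem_innerRegion ha hτ₀ hx hs0 hs.2
    have h1 : HasDerivAt (fun s : ℝ => s • x) x s := by
      simpa using (hasDerivAt_id' s).smul_const x
    have h2 : HasDerivAt (fun s : ℝ => F (s • x)) (fderiv ℝ F (s • x) x) s :=
      (h.hasFDerivAt ha hτ₀ hsx).comp_hasDerivAt s h1
    refine ((hasDerivAt_inv hs0.ne').fun_smul h2).congr_deriv ?_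
    have h3 := h.fderiv_apply_self ha hτ₀ hS hsx
    rw [map_smul] at h3
    rw [← h3, smul_smul, ← add_smul]
    have : s⁻¹ + -(s ^ 2)⁻¹ * s = 0 := by field_simp; ring
    rw [this, zero_smul]
  have := constant_of_has_deriv_right_zero
    (fun s hs => (hd s hs).continuousAt.continuousWithinAt)
    (fun s hs => (hd s (Ico_subset_Icc_self hs)).hasDerivWithinAt) 1 (right_mem_Icc.2 hε.2)
  simp only [inv_one, one_smul] at this
  rw [this, smul_smul, mul_inv_cancel₀ hε.1.ne', one_smul]

/-- An isometry which has a differential at the origin is equal to this differential. -/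
lemma map_eq_fderivWithin (hd : DifferentiableWithinAt ℝ F (region a τ₀) 0) {x : R4}
    (hx : x ∈ region a τ₀) : F x = fderivWithin ℝ F (region a τ₀) 0 x := by
  set L := fderivWithin ℝ F (region a τ₀) 0 with hL
  have hinner : ∀ x ∈ innerRegion a τ₀, F x = L x := by
    intro x hx
    have h1 : HasDerivWithinAt (fun s : ℝ => s • x) x (Icc 0 1) 0 := by
      simpa using ((hasDerivAt_id' (0 : ℝ)).smul_const x).hasDerivWithinAt
    have h2 : HasDerivWithinAt (fun s : ℝ => F (s • x)) (L x) (Icc 0 1) 0 := by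
      have h0 : HasFDerivWithinAt F L (region a τ₀) ((0 : ℝ) • x) := by
        rw [zero_smul]; exact hd.hasFDerivWithinAt
      exact h0.comp_hasDerivWithinAt 0 h1
        (fun s hs => smul_mem_region ha hτ₀ (innerRegion_subset hx) hs.1 hs.2)
    have h3 : HasDerivWithinAt (fun s : ℝ => F (s • x)) (F x) (Icc 0 1) 0 := by
      have h4 : HasDerivWithinAt (fun s : ℝ => s • F x) (F x) (Icc 0 1) 0 := by
        simpa using ((hasDerivAt_id' (0 : ℝ)).smul_const (F x)).hasDerivWithinAt
      have h5 : ∀ s ∈ Icc (0 : ℝ) 1, F (s • x) = s • F x := by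
        intro s hs
        rcases hs.1.eq_or_lt with rfl | h0
        · rw [zero_smul, zero_smul, h.map_zero]
        · exact h.map_smul_of_mem_Ioc ha hτ₀ hS hx ⟨h0, hs.2⟩
      exact h4.congr h5 (h5 0 (left_mem_Icc.2 zero_le_one))
    -- The one-sided derivative of `s ↦ F (s • x)` at `0` is `F x` by homogeneity and `L x` by the
    -- chain rule.
    exact (uniqueDiffOn_Icc zero_lt_one 0 (left_mem_Icc.2 zero_le_one)).eq_deriv _ h3 h2
  rcases hx.1.eq_or_lt with hq | hq
  · by_cases hx0 : x = 0
    · rw [hx0, h.map_zero, _root_.map_zero]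
    obtain ⟨v, hv⟩ := exists_eventually_add_smul_mem ha hτ₀ hq.symm
    have ht : Tendsto (fun s : ℝ => x + s • v) (𝓝[>] 0) (𝓝[region a τ₀] x) :=
      tendsto_nhdsWithin_iff.2 ⟨tendsto_add_smul x v, hv.mono fun s hs => innerRegion_subset hs⟩
    have h1 := (differentiableWithinAt h.contDiffOn hx hx0).continuousWithinAt.tendsto.comp ht
    have h2 := (L.continuous.tendsto x).comp (tendsto_add_smul x v)
    exact tendsto_nhds_unique h1 (h2.congr' (hv.mono fun s hs => (hinner _ hs).symm))
  · exact hinner x (mem_innerRegion_of_pos hx hq)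

end IsIsometryPair

/-! ## The group of isometries -/

lemma extendMap_apply {A : Set R4} (f : A → A) {x : R4} (hx : x ∈ A) :
    extendMap f x = f ⟨x, hx⟩ :=
  Subtype.val_injective.extend_apply (fun x => (f x : R4)) id ⟨x, hx⟩

/-- The action of the Lorentz group on a set which is a union of level sets of `quad`. -/
def lorentzPerm (A : Set R4) (hA : ∀ x ∈ A, ∀ y, quad y = quad x → y ∈ A) :
    lorentzGroup →* Equiv.Perm A where
  toFun Λ :=
    { toFun := fun x => ⟨((Λ : GL (Fin 4) ℝ) : Matrix (Fin 4) (Fin 4) ℝ) *ᵥ (x : R4),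
        hA x x.2 _ (by
          have := mink_mulVec Λ.2 x x
          rw [mink_self, mink_self] at this
          linarith)⟩
      invFun := fun x => ⟨((Λ⁻¹ : lorentzGroup) : GL (Fin 4) ℝ).val *ᵥ (x : R4),
        hA x x.2 _ (by
          have := mink_mulVec (Λ⁻¹).2 x x
          rw [mink_self, mink_self] at this
          linarith)⟩
      left_inv := fun x => Subtype.ext (by simp)
      right_inv := fun x => Subtype.ext (by simp) }
  map_one' := by ext x; simp
  map_mul' := fun Λ Λ' => by
    refine Equiv.ext fun x => Subtype.ext ?_
    simp [Matrix.mulVec_mulVec]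

section

variable {A : Set R4} {hA : ∀ x ∈ A, ∀ y, quad y = quad x → y ∈ A}

lemma lorentzPerm_apply (Λ : lorentzGroup) (x : A) :
    (lorentzPerm A hA Λ x : R4)
      = ((Λ : GL (Fin 4) ℝ) : Matrix (Fin 4) (Fin 4) ℝ) *ᵥ (x : R4) := rfl

/-- The continuous linear map given by a Lorentz matrix. -/
def lorentzCLM (Λ : lorentzGroup) : R4 →L[ℝ] R4 :=
  LinearMap.toContinuousLinearMap
    (Matrix.mulVecLin ((Λ : GL (Fin 4) ℝ) : Matrix (Fin 4) (Fin 4) ℝ))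

lemma lorentzCLM_apply (Λ : lorentzGroup) (v : R4) :
    lorentzCLM Λ v = ((Λ : GL (Fin 4) ℝ) : Matrix (Fin 4) (Fin 4) ℝ) *ᵥ v := rfl

lemma extendMap_lorentzPerm (Λ : lorentzGroup) {x : R4} (hx : x ∈ A) :
    extendMap (lorentzPerm A hA Λ) x = lorentzCLM Λ x := extendMap_apply _ hx

lemma fderivWithin_lorentzPerm (Λ : lorentzGroup) {x : R4} (hx : x ∈ A)
    (hu : UniqueDiffWithinAt ℝ A x) :
    fderivWithin ℝ (extendMap (lorentzPerm A hA Λ)) A x = lorentzCLM Λ :=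
  ((lorentzCLM Λ).hasFDerivWithinAt.congr (fun _ hy => extendMap_lorentzPerm Λ hy)
    (extendMap_lorentzPerm Λ hx)).fderivWithin hu

lemma contDiffOn_lorentzPerm (Λ : lorentzGroup) {n : WithTop ℕ∞} {B : Set R4} (hB : B ⊆ A) :
    ContDiffOn ℝ n (extendMap (lorentzPerm A hA Λ)) B :=
  (lorentzCLM Λ).contDiff.contDiffOn.congr fun _ hy => extendMap_lorentzPerm Λ (hB hy)

lemma lorentzPerm_injective {x : R4} (hx : x ∈ A) (hu : UniqueDiffWithinAt ℝ A x) :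
    Function.Injective (lorentzPerm A hA) := by
  intro Λ Λ' h
  have h1 := fderivWithin_lorentzPerm (hA := hA) Λ hx hu
  rw [h, fderivWithin_lorentzPerm Λ' hx hu] at h1
  refine Subtype.ext (Units.ext (Matrix.ext_of_mulVec_single fun i => ?_))
  exact (congrArg (fun T : R4 →L[ℝ] R4 => T (Pi.single i 1)) h1).symm

end

section

variable {a : ℝ → ℝ} {τ₀ : ℝ} {S : CoordSpacetime}

namespace IsPTExtension

lemma isFixingCausalIsometry_lorentzPerm (ha : IsScaleFactor a) (hτ₀ : 0 < τ₀)
    (hS : IsPTExtension a τ₀ S) (k : ℕ∞)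
    (hA : ∀ x ∈ S.causalSet 0, ∀ y, quad y = quad x → y ∈ S.causalSet 0) (Λ : lorentzGroup) :
    IsFixingCausalIsometry S k 0 (lorentzPerm (S.causalSet 0) hA Λ) := by
  have hJ := hS.causalSet_eq ha hτ₀
  have hu (x) (hx : x ∈ S.causalSet 0) : UniqueDiffWithinAt ℝ (S.causalSet 0) x := by
    rw [hJ] at hx ⊢
    exact uniqueDiffWithinAt_region ha hτ₀ hx
  have h0 : (0 : R4) ∈ S.causalSet 0 := by rw [hJ]; exact zero_mem_region
  refine ⟨fun x hx => ?_, contDiffOn_lorentzPerm Λ sdiff_subset, ?_, ?_, fun q X Y => ?_⟩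
  · rw [lorentzPerm_apply, hx, Matrix.mulVec_zero]
  · have : (lorentzPerm (S.causalSet 0) hA Λ).symm = lorentzPerm (S.causalSet 0) hA Λ⁻¹ :=
      (map_inv (lorentzPerm (S.causalSet 0) hA) Λ).symm
    rw [this]
    exact contDiffOn_lorentzPerm Λ⁻¹ sdiff_subset
  · exact ((lorentzCLM Λ).hasFDerivWithinAt.congr (fun _ hy => extendMap_lorentzPerm Λ hy)
      (extendMap_lorentzPerm Λ h0)).differentiableWithinAt
  · have hq : (q : R4) ∈ region a τ₀ := hJ ▸ q.2
    have hq' : (lorentzPerm (S.causalSet 0) hA Λ q : R4) ∈ region a τ₀ :=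
      hJ ▸ (lorentzPerm (S.causalSet 0) hA Λ q).2
    rw [fderivWithin_lorentzPerm Λ q.2 (hu q q.2), hS.metric_eq ha hτ₀ hq,
      hS.metric_eq ha hτ₀ hq', lorentzCLM_apply, lorentzCLM_apply, mink_mulVec Λ.2]
    have h1 : quad (lorentzPerm (S.causalSet 0) hA Λ q) = quad q := by
      have := mink_mulVec Λ.2 q q
      rw [mink_self, mink_self] at this
      rw [lorentzPerm_apply]
      linarith
    rw [h1]

lemma isIsometryPair (ha : IsScaleFactor a) (hτ₀ : 0 < τ₀) (hS : IsPTExtension a τ₀ S)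
    {k : ℕ∞} (hk : 1 ≤ k) {f : Equiv.Perm (S.causalSet 0)}
    (hf : IsFixingCausalIsometry S k 0 f) :
    IsIsometryPair S (region a τ₀) (extendMap f) (extendMap f.symm) := by
  have hk' : (1 : WithTop ℕ∞) ≤ k := by exact_mod_cast hk
  rw [← hS.causalSet_eq ha hτ₀]
  refine ⟨fun x hx => ?_, fun x hx => ?_, fun x hx => ?_, fun x hx => ?_, ?_,
    hf.contDiffOn.of_le hk', hf.contDiffOn_symm.of_le hk', fun x hx _ X Y => ?_⟩
  · rw [extendMap_apply _ hx]; exact (f ⟨x, hx⟩).2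
  · rw [extendMap_apply _ hx]; exact (f.symm ⟨x, hx⟩).2
  · rw [extendMap_apply _ hx, extendMap_apply _ (f ⟨x, hx⟩).2]; simp
  · rw [extendMap_apply _ hx, extendMap_apply _ (f.symm ⟨x, hx⟩).2]; simp
  · have h0 : (0 : R4) ∈ S.causalSet 0 := by
      rw [hS.causalSet_eq ha hτ₀]; exact zero_mem_region
    rw [extendMap_apply _ h0]
    exact hf.fixes ⟨0, h0⟩ rfl
  · rw [extendMap_apply _ hx]
    exact hf.isometry ⟨x, hx⟩ X Y

lemma exists_eq_lorentzPerm (ha : IsScaleFactor a) (hτ₀ : 0 < τ₀) (hS : IsPTExtension a τ₀ S)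
    {k : ℕ∞} (hk : 1 ≤ k)
    (hA : ∀ x ∈ S.causalSet 0, ∀ y, quad y = quad x → y ∈ S.causalSet 0)
    {f : Equiv.Perm (S.causalSet 0)} (hf : IsFixingCausalIsometry S k 0 f) :
    ∃ Λ, lorentzPerm (S.causalSet 0) hA Λ = f := by
  have hJ := hS.causalSet_eq ha hτ₀
  have hpair := hS.isIsometryPair ha hτ₀ hk hf
  have hlin : ∀ F G, IsIsometryPair S (region a τ₀) F G →
      DifferentiableWithinAt ℝ F (S.causalSet 0) 0 → ∀ x ∈ region a τ₀,
      F x = fderivWithin ℝ F (S.causalSet 0) 0 x := by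
    rw [hJ]
    exact fun F G h hd x hx => h.map_eq_fderivWithin ha hτ₀ hS hd hx
  have h0 : (0 : R4) ∈ S.causalSet 0 := by rw [hJ]; exact zero_mem_region
  have hiso (X Y : R4) : mink (fderivWithin ℝ (extendMap f) (S.causalSet 0) 0 X)
      (fderivWithin ℝ (extendMap f) (S.causalSet 0) 0 Y) = mink X Y := by
    have h1 := hf.isometry ⟨0, h0⟩ X Y
    rw [hf.fixes ⟨0, h0⟩ rfl] at h1
    rw [hS.metric_eq ha hτ₀ zero_mem_region, hS.metric_eq ha hτ₀ zero_mem_region] at h1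
    -- The origin is fixed, so both sides carry the same positive factor `conf 0`.
    exact (mul_left_cancel₀ (hS.conf_pos ha hτ₀ zero_mem_region).ne' h1).symm
  obtain ⟨Λ, hΛ⟩ := exists_lorentz hiso
  refine ⟨Λ, Equiv.ext fun x => Subtype.ext ?_⟩
  rw [lorentzPerm_apply, ← hΛ]
  have hx : (x : R4) ∈ region a τ₀ := hJ ▸ x.2
  rw [← hlin _ _ hpair hf.differentiableWithinAt x hx, extendMap_apply _ x.2]

end IsPTExtension

end

end Milne

end

/-! ### The main theorem. -/

theorem theorem2p2 (a : ℝ → ℝ) (ha : Milne.IsScaleFactor a) (τ₀ : ℝ) (hτ₀ : 0 < τ₀)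
    (S : Milne.CoordSpacetime) (hS : Milne.IsPTExtension a τ₀ S) (k : ℕ∞) (hk : 1 ≤ k) :
    Milne.IsManifoldWithBoundary (S.causalSet 0 \ {0}) ∧
    ∃ G : Subgroup (Equiv.Perm (S.causalSet 0)),
      (∀ f : Equiv.Perm (S.causalSet 0), f ∈ G ↔ Milne.IsFixingCausalIsometry S k 0 f) ∧
      ∃ Φ : Milne.lorentzGroup ≃* G, ∀ Λ : Milne.lorentzGroup,
        (∀ x : S.causalSet 0, (((Φ Λ : G) : Equiv.Perm (S.causalSet 0)) x : Milne.R4) =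
          ((Λ : GL (Fin 4) ℝ) : Matrix (Fin 4) (Fin 4) ℝ) *ᵥ (x : Milne.R4)) ∧
        (∀ v : Milne.R4, fderivWithin ℝ
          (Milne.extendMap ((Φ Λ : G) : Equiv.Perm (S.causalSet 0))) (S.causalSet 0) 0 v =
            ((Λ : GL (Fin 4) ℝ) : Matrix (Fin 4) (Fin 4) ℝ) *ᵥ v) := by
  have hJ := hS.causalSet_eq ha hτ₀
  have hA : ∀ x ∈ S.causalSet 0, ∀ y, Milne.quad y = Milne.quad x → y ∈ S.causalSet 0 := by
    rw [hJ]
    exact fun x hx y h => Milne.mem_region_of_quad_eq h hx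
  have h0 : (0 : Milne.R4) ∈ S.causalSet 0 := by rw [hJ]; exact Milne.zero_mem_region
  have hu : UniqueDiffWithinAt ℝ (S.causalSet 0) 0 := by
    rw [hJ]
    exact Milne.uniqueDiffWithinAt_region ha hτ₀ Milne.zero_mem_region
  -- Taking the group to be the image of the Lorentz group makes closure under composition and
  -- inverses automatic; injectivity holds because the differential at the origin recovers the
  -- matrix.
  refine ⟨?_, (Milne.lorentzPerm (S.causalSet 0) hA).range, fun f => ⟨?_, fun hf => ?_⟩,
    MonoidHom.ofInjective (Milne.lorentzPerm_injective h0 hu), fun Λ => ⟨fun x => ?_, fun v => ?_⟩⟩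
  · rw [hJ]
    exact Milne.isManifoldWithBoundary_region ha hτ₀
  · rintro ⟨Λ, rfl⟩
    exact hS.isFixingCausalIsometry_lorentzPerm ha hτ₀ k hA Λ
  · exact hS.exists_eq_lorentzPerm ha hτ₀ hk hA hf
  · rfl
  · rw [MonoidHom.ofInjective_apply, Milne.fderivWithin_lorentzPerm Λ h0 hu]
    rfl
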